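/- **Setting.** Let $\mathbb R^3_1$ be $\mathbb R^3$ with $\langle a,b\rangle=-a_1b_1+a_2b_2+a_3b_3$, its standard orientation, and the vector product given by $\langle a\times b,c\rangle=\det(a,b,c)$. A proper motion is a map $a\mapsto Aa+b$ where $A$ preserves $\langle\cdot,\cdot\rangle$ and $\det A=1$. A Lorentz surface $(D,x)$ is a smooth map $x:D\to\mathbb R^3_1$, $D\subset\mathbb R^2$ open with coordinates $(u,v)$, such that $EG-F^2<0$, where $E=\langle x_u,x_u\rangle$, $F=\langle x_u,x_v\rangle$, $G=\langle x_v,x_v\rangle$. With $l=\frac{x_u\times x_v}{|x_u\times x_v|}$, $L=\langle x_{uu},l\rangle$, $M=\langle x_{uv},l\rangle$, $N=\langle x_{vv},l\rangle$, the Gauss and mean curvatures are $$K=\frac{LN-M^2}{EG-F^2},\qquad H=\frac{EN-2FM+GL}{2(EG-F^2)}.$$ The surface is of general type if $H^2-K\neq0$ everywhere. The coordinates are isotropic if $E=G=0$ and $F>0$; on a surface of general type, isotropic coordinates are canonical with initial point $(u_0,v_0)\in D$ and signs $\varepsilon_1,\varepsilon_2\in\{1,-1\}$ if $L(u,v_0)=\varepsilon_1$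 whenever $(u,v_0)\in D$ and $N(u_0,v)=\varepsilon_2$ whenever $(u_0,v)\in D$. An open set $D$ is called admissible for $(u_0,v_0)\in D$ if for each $(u,v)\in D$ the segments from $(u,v)$ to $(u_0,v)$ and from $(u,v)$ to $(u,v_0)$ lie in $D$ (for example, $D$ is an open rectangle). The natural equation for a constant $H$ and a function $K$ of $(u,v)$ is $$\sqrt{|H^2-K|}\,\bigl(\ln\sqrt{|H^2-K|}\,\bigr)_{uv}=K,\qquad H^2-K\neq0.\tag{$*$}$$ **Theorem.** (1) Let $(D,x)$ be a Lorentz surface of general type in $\mathbb R^3_1$ with constant mean curvature $H\ne0$, parametrized by canonical isotropic coordinates with initial point $(u_0,v_0)$ and signs $\varepsilon_1,\varepsilon_2$, where $D$ is admissible for $(u_0,v_0)$. Then its Gauss curvature $K$ satisfies $(*)$ on $D$. If $(D,\hat x)$ is obtained from $(D,x)$ by a proper motion, then it is again such a surface, with the same $H$, $(u_0,v_0)$, $\varepsilon_1,\varepsilon_2$, and it has the same Gauss curvature, hence generates the same solution of $(*)$. (2) Conversely, let $H\ne0$ be a constant and let $K$ be a smooth function on an open set $D\subset\mathbb R^2$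 satisfying $(*)$. Then each $(u_0,v_0)\in D$ has an open rectangular neighbourhood $U\subset D$ on which there are signs $\varepsilon_1,\varepsilon_2\in\{1,-1\}$ and two Lorentz surfaces $(U,x_1)$, $(U,x_2)$ of general type, parametrized by canonical isotropic coordinates with initial point $(u_0,v_0)$, both with mean curvature $H$ and Gauss curvature $K$, the signs being $(\varepsilon_1,\varepsilon_2)$ for $x_1$ and $(-\varepsilon_1,-\varepsilon_2)$ for $x_2$. These are the only two up to proper motion, on $U$ and on smaller domains: for each open $V\subset U$ that is admissible for some $q_0\in V$, the restrictions of $x_1,x_2$ to $V$ are not related by a proper motion, and each Lorentz surface $(V,y)$ of general type with mean curvature $H$ and Gauss curvature $K$, parametrized by canonical isotropic coordinates with initial point $q_0$, either has the signs $(\varepsilon_1,\varepsilon_2)$ and is obtained from $x_1|_V$ by a proper motion, or has the signs $(-\varepsilon_1,-\varepsilon_2)$ and is obtained from $x_2|_V$ by a proper motion. -/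

import Mathlib

open scoped ContDiff

noncomputable section

namespace LorentzSurface

/-- The Minkowski scalar product `-a₁b₁ + a₂b₂ + a₃b₃` of `ℝ³₁`. -/
def mink (a b : Fin 3 → ℝ) : ℝ := -(a 0 * b 0) + a 1 * b 1 + a 2 * b 2

/-- The vector product of `ℝ³₁`: the vector `w` with `⟨w, c⟩ = det (a, b, c)` for every `c`
(see `mink_cross`). -/
def cross (a b : Fin 3 → ℝ) : Fin 3 → ℝ :=
  ![-(a 1 * b 2 - a 2 * b 1), a 2 * b 0 - a 0 * b 2, a 0 * b 1 - a 1 * b 0]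

theorem mink_cross (a b c : Fin 3 → ℝ) :
    mink (cross a b) c = Matrix.det (Matrix.of ![a, b, c]) := by
  simp [mink, cross, Matrix.det_fin_three]
  ring

/-- The partial derivative `f_u` of a function of `(u, v)`. -/
def du {E : Type*} [NormedAddCommGroup E] [NormedSpace ℝ E] (f : ℝ × ℝ → E) (p : ℝ × ℝ) : E :=
  fderiv ℝ f p (1, 0)

/-- The partial derivative `f_v` of a function of `(u, v)`. -/
def dv {E : Type*} [NormedAddCommGroup E] [NormedSpace ℝ E] (f : ℝ × ℝ → E) (p : ℝ × ℝ) : E :=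
  fderiv ℝ f p (0, 1)

/-- Coefficient `E = ⟨x_u, x_u⟩` of the first fundamental form. -/
def coeffE (x : ℝ × ℝ → Fin 3 → ℝ) (p : ℝ × ℝ) : ℝ := mink (du x p) (du x p)

/-- Coefficient `F = ⟨x_u, x_v⟩` of the first fundamental form. -/
def coeffF (x : ℝ × ℝ → Fin 3 → ℝ) (p : ℝ × ℝ) : ℝ := mink (du x p) (dv x p)

/-- Coefficient `G = ⟨x_v, x_v⟩` of the first fundamental form. -/
def coeffG (x : ℝ × ℝ → Fin 3 → ℝ) (p : ℝ × ℝ) : ℝ := mink (dv x p) (dv x p)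

/-- The unit normal `l = (x_u × x_v) / |x_u × x_v|`, where `|w| = √|⟨w, w⟩|`; the frame
`(x_u, x_v, l)` is positively oriented. -/
def normal (x : ℝ × ℝ → Fin 3 → ℝ) (p : ℝ × ℝ) : Fin 3 → ℝ :=
  (Real.sqrt |mink (cross (du x p) (dv x p)) (cross (du x p) (dv x p))|)⁻¹ •
    cross (du x p) (dv x p)

/-- Coefficient `L = ⟨x_uu, l⟩` of the second fundamental form. -/
def coeffL (x : ℝ × ℝ → Fin 3 → ℝ) (p : ℝ × ℝ) : ℝ := mink (du (du x) p) (normal x p)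

/-- Coefficient `M = ⟨x_uv, l⟩` of the second fundamental form. -/
def coeffM (x : ℝ × ℝ → Fin 3 → ℝ) (p : ℝ × ℝ) : ℝ := mink (dv (du x) p) (normal x p)

/-- Coefficient `N = ⟨x_vv, l⟩` of the second fundamental form. -/
def coeffN (x : ℝ × ℝ → Fin 3 → ℝ) (p : ℝ × ℝ) : ℝ := mink (dv (dv x) p) (normal x p)

/-- The Gauss curvature `K = (LN - M²) / (EG - F²)`. -/
def gaussCurv (x : ℝ × ℝ → Fin 3 → ℝ) (p : ℝ × ℝ) : ℝ :=
  (coeffL x p * coeffN x p - coeffM x p ^ 2) / (coeffE x p * coeffG x p - coeffF x p ^ 2)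

/-- The mean curvature `H = (EN - 2FM + GL) / (2 (EG - F²))`. -/
def meanCurv (x : ℝ × ℝ → Fin 3 → ℝ) (p : ℝ × ℝ) : ℝ :=
  (coeffE x p * coeffN x p - 2 * coeffF x p * coeffM x p + coeffG x p * coeffL x p) /
    (2 * (coeffE x p * coeffG x p - coeffF x p ^ 2))

/-- `(D, x)` is a smooth Lorentz surface: the induced metric on the open set `D` is Lorentzian.
The last condition forces `x_u`, `x_v` to be linearly independent, so `x` is an immersion. -/
structure IsLorentzSurface (x : ℝ × ℝ → Fin 3 → ℝ) (D : Set (ℝ × ℝ)) : Prop where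
  isOpen : IsOpen D
  smooth : ContDiffOn ℝ ∞ x D
  lorentz : ∀ p ∈ D, coeffE x p * coeffG x p - coeffF x p ^ 2 < 0

/-- `(D, x)` is of general type: `H² - K ≠ 0`. -/
def IsGeneralType (x : ℝ × ℝ → Fin 3 → ℝ) (D : Set (ℝ × ℝ)) : Prop :=
  ∀ p ∈ D, meanCurv x p ^ 2 - gaussCurv x p ≠ 0

/-- The coordinates `(u, v)` of `(D, x)` are isotropic, with the normalization `F > 0`. -/
def IsIsotropic (x : ℝ × ℝ → Fin 3 → ℝ) (D : Set (ℝ × ℝ)) : Prop :=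
  ∀ p ∈ D, coeffE x p = 0 ∧ coeffG x p = 0 ∧ 0 < coeffF x p

/-- The isotropic coordinates `(u, v)` of `(D, x)` are canonical with initial point
`p₀ = (u₀, v₀)` and signs `ε₁`, `ε₂`: `L(u, v₀) = ε₁` and `N(u₀, v) = ε₂`. -/
structure IsCanonical (x : ℝ × ℝ → Fin 3 → ℝ) (D : Set (ℝ × ℝ)) (p₀ : ℝ × ℝ) (ε₁ ε₂ : ℝ) :
    Prop where
  isotropic : IsIsotropic x D
  mem : p₀ ∈ D
  sign₁ : ε₁ = 1 ∨ ε₁ = -1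
  sign₂ : ε₂ = 1 ∨ ε₂ = -1
  L_eq : ∀ u : ℝ, (u, p₀.2) ∈ D → coeffL x (u, p₀.2) = ε₁
  N_eq : ∀ v : ℝ, (p₀.1, v) ∈ D → coeffN x (p₀.1, v) = ε₂

/-- `(D, x)` is a Lorentz surface of general type with constant mean curvature `H`, parametrized
by canonical isotropic coordinates with initial point `p₀` and signs `ε₁`, `ε₂`. -/
structure IsCanonicalCMC (x : ℝ × ℝ → Fin 3 → ℝ) (D : Set (ℝ × ℝ)) (p₀ : ℝ × ℝ) (ε₁ ε₂ H : ℝ) :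
    Prop where
  surface : IsLorentzSurface x D
  generalType : IsGeneralType x D
  canonical : IsCanonical x D p₀ ε₁ ε₂
  mean : ∀ p ∈ D, meanCurv x p = H

/-- Every point `(u, v)` of `D` is joined inside `D` to `(u₀, v)` by a `u`-segment and to
`(u, v₀)` by a `v`-segment (for instance, `D` is a rectangle containing `(u₀, v₀)`). -/
def IsCoordStar (D : Set (ℝ × ℝ)) (p₀ : ℝ × ℝ) : Prop :=
  p₀ ∈ D ∧ ∀ p ∈ D, (∀ t ∈ Set.uIcc p₀.1 p.1, (t, p.2) ∈ D) ∧
    ∀ t ∈ Set.uIcc p₀.2 p.2, (p.1, t) ∈ D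

/-- The surface `(D, y)` is obtained from `(D, x)` by a proper motion of `ℝ³₁`, i.e. by a map
`a ↦ A a + b` where `A` preserves the scalar product and `det A = 1`. -/
def ProperlyCongruent (x y : ℝ × ℝ → Fin 3 → ℝ) (D : Set (ℝ × ℝ)) : Prop :=
  ∃ (A : Matrix (Fin 3) (Fin 3) ℝ) (b : Fin 3 → ℝ),
    (∀ a c : Fin 3 → ℝ, mink (A.mulVec a) (A.mulVec c) = mink a c) ∧ A.det = 1 ∧
      ∀ p ∈ D, y p = A.mulVec (x p) + b

/-- The natural equation `√|H² - K| (ln √|H² - K|)_uv = K`, `H² - K ≠ 0`, on `D`. -/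
def NaturalEq (H : ℝ) (K : ℝ × ℝ → ℝ) (D : Set (ℝ × ℝ)) : Prop :=
  ∀ p ∈ D, H ^ 2 - K p ≠ 0 ∧
    Real.sqrt |H ^ 2 - K p| * dv (du fun q => Real.log (Real.sqrt |H ^ 2 - K q|)) p = K p

end LorentzSurface

end

noncomputable section

namespace LorentzSurface

open MeasureTheory Metric Set Filter Topology

/-! ### Partial derivatives on the plane and smooth cut-offs. -/

section Calculus

variable {E : Type*} [NormedAddCommGroup E] [NormedSpace ℝ E]

/-! In isotropic coordinates the mean curvature is `M / F`, so constant `H` means `M = H F`, and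
then `H² - K = L N / F²`. The Codazzi equations reduce to `L_v = 0` and `N_u = 0`; on an admissible
domain the canonical normalization therefore spreads to `L = ε₁`, `N = ε₂` everywhere (`coeffL_eq`,
`coeffN_eq`). Hence `F = |H² - K|^(-1/2)`, and the Gauss equation `(ln F)_uv = -K F` is exactly the
natural equation. Proper motions preserve both fundamental forms, hence all of these data.

Conversely, a solution `K` prescribes `F = |H² - K|^(-1/2)` and the product `ε₁ ε₂`, the sign of `H²
- K`. This leaves two opposite pairs of signs. For each pair the Gauss-Weingarten equations,
together with `x_u = X`, `x_v = Y`, form a linear system whose compatibility condition is the Gauss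
equation. The Frobenius theorem `exists_solution_linear_system` solves it locally, and
`exists_isCanonicalCMC` checks that the solution is a surface: the relations between the frame
vectors hold at the initial point and propagate, because the tensor `(X ⊗ Y + Y ⊗ X) / F + l ⊗ l`
and the quotient `det (X, Y, l) / F` are constant.

For uniqueness, two surfaces with the same `K` and the same signs have the same `F`, `L`, `M`, `N`.
Pairing the two frames in the same tensor gives a constant linear map carrying one frame to the
other (`exists_motion`), and integration yields the translation. The two sign pairs are never
properly congruent, since a proper motion preserves `L`. -/

theorem hasDerivAt_slice_left {f : ℝ × ℝ → E} {s t : ℝ} (hf : DifferentiableAt ℝ f (s, t)) :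
    HasDerivAt (fun s => f (s, t)) (du f (s, t)) s := by
  have h : HasDerivAt (fun s : ℝ => (s, t)) ((1 : ℝ), (0 : ℝ)) s :=
    (hasDerivAt_id s).prodMk (hasDerivAt_const s t)
  exact hf.hasFDerivAt.comp_hasDerivAt s h

theorem hasDerivAt_slice_right {f : ℝ × ℝ → E} {s t : ℝ} (hf : DifferentiableAt ℝ f (s, t)) :
    HasDerivAt (fun t => f (s, t)) (dv f (s, t)) t := by
  have h : HasDerivAt (fun t : ℝ => (s, t)) ((0 : ℝ), (1 : ℝ)) t :=
    (hasDerivAt_const t s).prodMk (hasDerivAt_id t)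
  exact hf.hasFDerivAt.comp_hasDerivAt t h

theorem contDiffOn_du {f : ℝ × ℝ → E} {D : Set (ℝ × ℝ)} (hD : IsOpen D)
    (hf : ContDiffOn ℝ ∞ f D) : ContDiffOn ℝ ∞ (du f) D :=
  ((contDiffOn_infty_iff_fderiv_of_isOpen hD).1 hf).2.clm_apply contDiffOn_const

theorem contDiffOn_dv {f : ℝ × ℝ → E} {D : Set (ℝ × ℝ)} (hD : IsOpen D)
    (hf : ContDiffOn ℝ ∞ f D) : ContDiffOn ℝ ∞ (dv f) D :=
  ((contDiffOn_infty_iff_fderiv_of_isOpen hD).1 hf).2.clm_apply contDiffOn_const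

theorem fderiv_eq_zero_of_du_dv {f : ℝ × ℝ → E} {p : ℝ × ℝ} (hu : du f p = 0) (hv : dv f p = 0) :
    fderiv ℝ f p = 0 := by
  ext1
  · ext1; simpa [du] using hu
  · ext1; simpa [dv] using hv

theorem du_congr {f g : ℝ × ℝ → E} {p : ℝ × ℝ} (h : f =ᶠ[𝓝 p] g) : du f p = du g p := by
  rw [du, h.fderiv_eq, du]

theorem dv_congr {f g : ℝ × ℝ → E} {p : ℝ × ℝ} (h : f =ᶠ[𝓝 p] g) : dv f p = dv g p := by
  rw [dv, h.fderiv_eq, dv]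

theorem du_congr_on {f g : ℝ × ℝ → E} {D : Set (ℝ × ℝ)} (hD : IsOpen D) (h : EqOn f g D) :
    EqOn (du f) (du g) D := fun _ hp => du_congr (h.eventuallyEq_of_mem (hD.mem_nhds hp))

theorem dv_congr_on {f g : ℝ × ℝ → E} {D : Set (ℝ × ℝ)} (hD : IsOpen D) (h : EqOn f g D) :
    EqOn (dv f) (dv g) D := fun _ hp => dv_congr (h.eventuallyEq_of_mem (hD.mem_nhds hp))

/-- Mixed second partial derivatives of a smooth function agree. -/
theorem dv_du_comm {f : ℝ × ℝ → E} {p : ℝ × ℝ} (hf : ContDiffAt ℝ ∞ f p) :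
    dv (du f) p = du (dv f) p := by
  have h2 : IsSymmSndFDerivAt ℝ f p := by
    refine hf.isSymmSndFDerivAt ?_
    simp only [minSmoothness_of_isRCLikeNormedField]
    exact WithTop.coe_le_coe.2 (le_top : (2 : ℕ∞) ≤ ⊤)
  have hd : DifferentiableAt ℝ (fderiv ℝ f) p :=
    (hf.fderiv_right (m := ∞) (by simp)).differentiableAt (by simp)
  have e : ∀ w z : ℝ × ℝ, fderiv ℝ (fun q => fderiv ℝ f q w) p z = fderiv ℝ (fderiv ℝ f) p z w := by
    intro w z
    rw [fderiv_clm_apply hd (differentiableAt_const w)]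
    simp
  change fderiv ℝ (fun q => fderiv ℝ f q (1, 0)) p (0, 1) =
    fderiv ℝ (fun q => fderiv ℝ f q (0, 1)) p (1, 0)
  rw [e, e]
  exact h2 _ _

/-- A smooth function on an open set agrees near a given point with a compactly supported one. -/
theorem exists_contDiff_hasCompactSupport_eventuallyEq {f : ℝ × ℝ → E} {D : Set (ℝ × ℝ)}
    (hD : IsOpen D) (hf : ContDiffOn ℝ ∞ f D) {p₀ : ℝ × ℝ} (hp₀ : p₀ ∈ D) :
    ∃ g : ℝ × ℝ → E, ContDiff ℝ ∞ g ∧ HasCompactSupport g ∧ g =ᶠ[𝓝 p₀] f := by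
  obtain ⟨R, hR, hRD⟩ := nhds_basis_closedBall.mem_iff.1 (hD.mem_nhds hp₀)
  let χ : ContDiffBump p₀ := ⟨R / 2, R, by positivity, by linarith⟩
  refine ⟨fun p => χ p • f p, ?_, ?_, ?_⟩
  · rw [contDiff_iff_contDiffAt]
    intro p
    by_cases hp : p ∈ closedBall p₀ R
    · exact (χ.contDiff.contDiffAt).smul (hf.contDiffAt (hD.mem_nhds (hRD hp)))
    · have : (fun p => χ p • f p) =ᶠ[𝓝 p] fun _ => 0 := by
        filter_upwards [isClosed_closedBall.isOpen_compl.mem_nhds hp] with q hq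
        rw [χ.zero_of_le_dist, zero_smul]
        simp only [mem_compl_iff, mem_closedBall, not_le] at hq
        exact hq.le
      exact contDiffAt_const.congr_of_eventuallyEq this
  · exact χ.hasCompactSupport.smul_right
  · filter_upwards [χ.eventuallyEq_one] with p hp
    rw [hp, Pi.one_apply, one_smul]

end Calculus

/-! ### Picard iteration for the integral equation behind the Frobenius theorem. -/

section Frobenius

variable {𝔸 : Type*} [NormedRing 𝔸] [NormedAlgebra ℝ 𝔸]

/-- The nearest point projection of `ℝ` to the interval `[c - r, c + r]`. -/
def clamp (c r t : ℝ) : ℝ := max (c - r) (min t (c + r))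

theorem continuous_clamp (c r : ℝ) : Continuous (clamp c r) := by
  unfold clamp; fun_prop

theorem abs_clamp_sub_le {c r : ℝ} (hr : 0 ≤ r) (t : ℝ) : |clamp c r t - c| ≤ r := by
  unfold clamp
  rw [abs_le]
  constructor
  · linarith [le_max_left (c - r) (min t (c + r))]
  · linarith [max_le (show c - r ≤ c + r by linarith) (min_le_right t (c + r))]

theorem clamp_eq_self {c r t : ℝ} (h : |t - c| ≤ r) : clamp c r t = t := by
  obtain ⟨h1, h2⟩ := abs_le.1 h
  rw [clamp, min_eq_left (by linarith), max_eq_right (by linarith)]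

theorem norm_intervalIntegral_mul_le {f g : ℝ → 𝔸} {C B r c d : ℝ} (hC : ∀ t, ‖f t‖ ≤ C)
    (hB : ∀ t ∈ uIcc c d, ‖g t‖ ≤ B) (hd : |d - c| ≤ r) (hC0 : 0 ≤ C) (hB0 : 0 ≤ B) :
    ‖∫ t in c..d, f t * g t‖ ≤ C * B * r := by
  have h := intervalIntegral.norm_integral_le_of_norm_le_const (a := c) (b := d)
    (f := fun t => f t * g t) (C := C * B) (fun t ht => (norm_mul_le _ _).trans
      (mul_le_mul (hC t) (hB t (uIoc_subset_uIcc ht)) (norm_nonneg _) hC0))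
  exact h.trans (mul_le_mul_of_nonneg_left hd (by positivity))

variable [CompleteSpace 𝔸]

open BoundedContinuousFunction in
/-- Local solvability of the integral equation for the system `P_u = a P` on `v = v₀`,
`P_v = b P`. -/
theorem exists_continuous_integral_solution {a b : ℝ × ℝ → 𝔸} (ha : Continuous a)
    (hb : Continuous b) {C r : ℝ} (hC0 : 0 ≤ C) (haC : ∀ p, ‖a p‖ ≤ C) (hbC : ∀ p, ‖b p‖ ≤ C)
    (hr : 0 ≤ r) (hrC : 2 * (C * r) < 1) (p₀ : ℝ × ℝ) :
    ∃ P : ℝ × ℝ → 𝔸, Continuous P ∧ ∀ p ∈ closedBall p₀ r,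
      P p = 1 + (∫ s in p₀.1..p.1, a (s, p₀.2) * P (s, p₀.2)) +
        ∫ t in p₀.2..p.2, b (p.1, t) * P (p.1, t) := by
  -- Clamping the upper limits bounds the length of integration by `r` at every point, so the fixed
  -- point problem lives on bounded continuous functions on the whole plane; on the closed ball of
  -- radius `r` the clamp is the identity.
  let I₁ (P : ℝ × ℝ → 𝔸) (p : ℝ × ℝ) : 𝔸 :=
    ∫ s in p₀.1..clamp p₀.1 r p.1, a (s, p₀.2) * P (s, p₀.2)
  let I₂ (P : ℝ × ℝ → 𝔸) (p : ℝ × ℝ) : 𝔸 :=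
    ∫ t in p₀.2..clamp p₀.2 r p.2, b (p.1, t) * P (p.1, t)
  have hI₁ : ∀ P : ℝ × ℝ → 𝔸, Continuous P → Continuous (I₁ P) := fun P hP =>
    intervalIntegral.continuous_parametric_intervalIntegral_of_continuous
      (f := fun _ s => a (s, p₀.2) * P (s, p₀.2)) (by fun_prop)
      ((continuous_clamp _ _).comp continuous_fst)
  have hI₂ : ∀ P : ℝ × ℝ → 𝔸, Continuous P → Continuous (I₂ P) := fun P hP =>
    intervalIntegral.continuous_parametric_intervalIntegral_of_continuous
      (f := fun (p : ℝ × ℝ) t => b (p.1, t) * P (p.1, t)) (by fun_prop)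
      ((continuous_clamp _ _).comp continuous_snd)
  have nI : ∀ (P : ℝ × ℝ → 𝔸) (B : ℝ), 0 ≤ B → (∀ p, ‖P p‖ ≤ B) → ∀ p,
      ‖I₁ P p + I₂ P p‖ ≤ 2 * (C * r) * B := by
    intro P B hB hP p
    have h1 : ‖I₁ P p‖ ≤ C * B * r := norm_intervalIntegral_mul_le (fun _ => haC _)
      (fun _ _ => hP _) (abs_clamp_sub_le hr _) hC0 hB
    have h2 : ‖I₂ P p‖ ≤ C * B * r := norm_intervalIntegral_mul_le (fun _ => hbC _)
      (fun _ _ => hP _) (abs_clamp_sub_le hr _) hC0 hB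
    linarith [norm_add_le (I₁ P p) (I₂ P p)]
  let T (P : ℝ × ℝ →ᵇ 𝔸) : ℝ × ℝ →ᵇ 𝔸 :=
    BoundedContinuousFunction.ofNormedAddCommGroup (fun p => 1 + (I₁ P p + I₂ P p))
      (continuous_const.add ((hI₁ P P.continuous).add (hI₂ P P.continuous)))
      (‖(1 : 𝔸)‖ + 2 * (C * r) * ‖P‖) (fun p => (norm_add_le _ _).trans
        (add_le_add_right (nI P _ (norm_nonneg P) P.norm_coe_le_norm p) _))
  obtain ⟨κ, hκ⟩ : ∃ κ : NNReal, (κ : ℝ) = 2 * (C * r) := ⟨⟨2 * (C * r), by positivity⟩, rfl⟩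
  have hT : ContractingWith κ T := by
    refine ⟨by rw [← NNReal.coe_lt_coe, hκ]; exact_mod_cast hrC, LipschitzWith.of_dist_le_mul fun P Q => ?_⟩
    rw [hκ, BoundedContinuousFunction.dist_le (by positivity)]
    intro p
    have e₁ : I₁ P p - I₁ Q p = I₁ (P - Q) p := by
      simp only [I₁]
      rw [← intervalIntegral.integral_sub]
      · simp [mul_sub]
      · exact (Continuous.intervalIntegrable (by fun_prop) _ _)
      · exact (Continuous.intervalIntegrable (by fun_prop) _ _)
    have e₂ : I₂ P p - I₂ Q p = I₂ (P - Q) p := by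
      simp only [I₂]
      rw [← intervalIntegral.integral_sub]
      · simp [mul_sub]
      · exact (Continuous.intervalIntegrable (by fun_prop) _ _)
      · exact (Continuous.intervalIntegrable (by fun_prop) _ _)
    have : T P p - T Q p = I₁ (P - Q) p + I₂ (P - Q) p := by
      rw [← e₁, ← e₂]
      simp only [T, BoundedContinuousFunction.coe_ofNormedAddCommGroup]
      abel
    rw [dist_eq_norm, this, dist_eq_norm]
    exact nI _ _ (norm_nonneg _) (P - Q).norm_coe_le_norm p
  let Q : ℝ × ℝ →ᵇ 𝔸 := ContractingWith.fixedPoint T hT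
  have hQ : T Q = Q := hT.fixedPoint_isFixedPt
  refine ⟨Q, Q.continuous, fun p hp => ?_⟩
  have hfix := congrArg (fun P : ℝ × ℝ →ᵇ 𝔸 => P p) hQ
  rw [mem_closedBall, Prod.dist_eq, max_le_iff, Real.dist_eq, Real.dist_eq] at hp
  simp only [T, BoundedContinuousFunction.coe_ofNormedAddCommGroup, I₁, I₂,
    clamp_eq_self hp.1, clamp_eq_self hp.2] at hfix
  rw [add_assoc]
  exact hfix.symm

end Frobenius

/-! ### Compatibility, regularity and the Frobenius theorem. -/

section Frobenius

variable {𝔸 : Type*} [NormedRing 𝔸]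

theorem mem_ball_iff_abs {p p₀ : ℝ × ℝ} {r : ℝ} :
    p ∈ ball p₀ r ↔ |p.1 - p₀.1| < r ∧ |p.2 - p₀.2| < r := by
  rw [mem_ball, Prod.dist_eq, max_lt_iff, Real.dist_eq, Real.dist_eq]

theorem mem_ball_left_of_mem_uIcc {p p₀ : ℝ × ℝ} {r s : ℝ} (hp : p ∈ ball p₀ r)
    (hs : s ∈ uIcc p₀.1 p.1) : (s, p.2) ∈ ball p₀ r := by
  rw [mem_ball_iff_abs] at hp ⊢
  exact ⟨(abs_sub_left_of_mem_uIcc hs).trans_lt hp.1, hp.2⟩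

theorem mem_ball_right_of_mem_uIcc {p p₀ : ℝ × ℝ} {r t : ℝ} (hp : p ∈ ball p₀ r)
    (ht : t ∈ uIcc p₀.2 p.2) : (p.1, t) ∈ ball p₀ r := by
  rw [mem_ball_iff_abs] at hp ⊢
  exact ⟨hp.1, (abs_sub_left_of_mem_uIcc ht).trans_lt hp.2⟩

/-- A bounded quantity which is smaller than itself by a factor less than one vanishes. -/
theorem eq_zero_of_bound_improves {X : Type*} {S : Set X} {f : X → 𝔸} {κ B : ℝ} (hκ0 : 0 ≤ κ)
    (hκ : κ < 1) (hB0 : 0 ≤ B) (hB : ∀ x ∈ S, ‖f x‖ ≤ B)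
    (h : ∀ B, 0 ≤ B → (∀ x ∈ S, ‖f x‖ ≤ B) → ∀ x ∈ S, ‖f x‖ ≤ κ * B) :
    ∀ x ∈ S, f x = 0 := by
  have hn : ∀ n : ℕ, ∀ x ∈ S, ‖f x‖ ≤ κ ^ n * B := by
    intro n
    induction n with
    | zero => simpa using hB
    | succ n ih =>
      intro x hx
      have := h _ (by positivity) ih x hx
      rwa [pow_succ', mul_assoc]
  intro x hx
  have hl : Tendsto (fun n : ℕ => κ ^ n * B) atTop (𝓝 0) := by
    simpa using (tendsto_pow_atTop_nhds_zero_of_lt_one hκ0 hκ).mul_const B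
  exact norm_le_zero_iff.1 (ge_of_tendsto' hl fun n => hn n x hx)

variable [NormedAlgebra ℝ 𝔸]

/-- Solutions of a linear system with smooth coefficients are smooth. -/
theorem contDiffOn_of_linear_system {a b P : ℝ × ℝ → 𝔸} {D : Set (ℝ × ℝ)} (hD : IsOpen D)
    (ha : ContDiffOn ℝ ∞ a D) (hb : ContDiffOn ℝ ∞ b D)
    (hP : ∀ p ∈ D, HasFDerivAt P ((ContinuousLinearMap.toSpanSingleton ℝ (a p * P p)).coprod
      (ContinuousLinearMap.toSpanSingleton ℝ (b p * P p))) p) : ContDiffOn ℝ ∞ P D := by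
  rw [contDiffOn_infty]
  intro n
  -- Bootstrapping: the derivative of `P` is built from `a P` and `b P`, so it is as regular as `P`
  -- itself.
  induction n with
  | zero => exact contDiffOn_zero.2 fun p hp => (hP p hp).continuousAt.continuousWithinAt
  | succ n ih =>
    push_cast
    rw [contDiffOn_succ_iff_fderiv_of_isOpen hD]
    refine ⟨fun p hp => (hP p hp).differentiableAt.differentiableWithinAt, by simp, ?_⟩
    have h1 : ContDiffOn ℝ n (fun p => a p * P p) D := (contDiffOn_infty.1 ha n).mul ih
    have h2 : ContDiffOn ℝ n (fun p => b p * P p) D := (contDiffOn_infty.1 hb n).mul ih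
    have h3 := (ContinuousLinearMap.toSpanSingletonCLE (𝕜 := ℝ) (E := 𝔸)).contDiff.comp_contDiffOn h1
    have h4 := (ContinuousLinearMap.toSpanSingletonCLE (𝕜 := ℝ) (E := 𝔸)).contDiff.comp_contDiffOn h2
    have h5 := (h3.clm_comp (contDiffOn_const (c := ContinuousLinearMap.fst ℝ ℝ ℝ))).add
      (h4.clm_comp (contDiffOn_const (c := ContinuousLinearMap.snd ℝ ℝ ℝ)))
    refine h5.congr fun p hp => ?_
    rw [(hP p hp).fderiv]
    ext1 <;> ext1 <;> simp

variable [CompleteSpace 𝔸]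

/-- The solution of the integral equation satisfies `P_u = a P` in integrated form, provided the
system is compatible. -/
theorem integral_solution_eq {a b P : ℝ × ℝ → 𝔸} (ha : ContDiff ℝ ∞ a) (hb : ContDiff ℝ ∞ b)
    (hP : Continuous P) {C r : ℝ} {p₀ : ℝ × ℝ} (hC0 : 0 ≤ C) (hbC : ∀ p, ‖b p‖ ≤ C)
    (hdbC : ∀ p, ‖du b p‖ ≤ C) (hr : 0 < r) (hrC : r * (C + C * r) < 1)
    (hcomp : ∀ p ∈ ball p₀ r, dv a p + a p * b p = du b p + b p * a p)
    (hPeq : ∀ p ∈ ball p₀ r, P p = 1 + (∫ s in p₀.1..p.1, a (s, p₀.2) * P (s, p₀.2)) +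
        ∫ t in p₀.2..p.2, b (p.1, t) * P (p.1, t)) :
    ∀ p ∈ ball p₀ r, P p = P (p₀.1, p.2) + ∫ s in p₀.1..p.1, a (s, p.2) * P (s, p.2) := by
  have hac := ha.continuous
  have hbc := hb.continuous
  have hda : Continuous (dv a) := (ha.continuous_fderiv (by simp)).clm_apply continuous_const
  have hdb : Continuous (du b) := (hb.continuous_fderiv (by simp)).clm_apply continuous_const
  have had : Differentiable ℝ a := ha.differentiable (by simp)
  have hbd : Differentiable ℝ b := hb.differentiable (by simp)
  -- `P` is not yet known to be differentiable in `u`, so the equation `P_u = a P` cannot be tested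
  -- directly. The competitor `Pt` satisfies `Pt_u = a P` by construction, and the claim becomes `Pt
  -- = P`.
  let Pt (p : ℝ × ℝ) : 𝔸 := P (p₀.1, p.2) + ∫ s in p₀.1..p.1, a (s, p.2) * P (s, p.2)
  have hPt : Continuous Pt := by
    refine (hP.comp (by fun_prop)).add ?_
    exact intervalIntegral.continuous_parametric_intervalIntegral_of_continuous
      (f := fun (p : ℝ × ℝ) s => a (s, p.2) * P (s, p.2)) (by fun_prop) continuous_fst
  have hPv : ∀ p ∈ ball p₀ r, HasDerivAt (fun t => P (p.1, t)) (b p * P p) p.2 := by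
    intro p hp
    have h1 : HasDerivAt (fun t => ∫ t in p₀.2..t, b (p.1, t) * P (p.1, t)) (b p * P p) p.2 :=
      (Continuous.integral_hasStrictDerivAt (by fun_prop) p₀.2 p.2).hasDerivAt
    refine (h1.const_add (1 + ∫ s in p₀.1..p.1, a (s, p₀.2) * P (s, p₀.2))).congr_of_eventuallyEq ?_
    have : ∀ᶠ t in 𝓝 p.2, (p.1, t) ∈ ball p₀ r :=
      (Continuous.prodMk_right p.1).continuousAt.eventually (isOpen_ball.mem_nhds hp)
    filter_upwards [this] with t ht
    exact hPeq _ ht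
  have hPtu : ∀ p : ℝ × ℝ, HasDerivAt (fun s => Pt (s, p.2)) (a p * P p) p.1 := by
    intro p
    have h1 : HasDerivAt (fun s => ∫ s in p₀.1..s, a (s, p.2) * P (s, p.2)) (a p * P p) p.1 :=
      (Continuous.integral_hasStrictDerivAt (by fun_prop) p₀.1 p.1).hasDerivAt
    exact h1.const_add (P (p₀.1, p.2))
  have e1 : ∀ p ∈ ball p₀ r, P p = P (p.1, p₀.2) + ∫ t in p₀.2..p.2, b (p.1, t) * P (p.1, t) := by
    intro p hp
    have h := hPeq _ (mem_ball_right_of_mem_uIcc hp left_mem_uIcc)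
    simp only [intervalIntegral.integral_same, add_zero] at h
    rw [h]; exact hPeq p hp
  have e2 : ∀ p ∈ ball p₀ r, Pt (p.1, p₀.2) = P (p.1, p₀.2) := by
    intro p hp
    have h := hPeq _ (mem_ball_right_of_mem_uIcc hp left_mem_uIcc)
    have h0 := hPeq p₀ (mem_ball_self hr)
    simp only [intervalIntegral.integral_same, add_zero] at h h0
    simp only [Pt]
    rw [h, h0]
  have e3 : ∀ p ∈ ball p₀ r, ∫ t in p₀.2..p.2, (dv a (p.1, t) * P (p.1, t) +
      a (p.1, t) * (b (p.1, t) * P (p.1, t))) = a p * P p - a (p.1, p₀.2) * P (p.1, p₀.2) := by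
    intro p hp
    refine intervalIntegral.integral_eq_sub_of_hasDerivAt (f := fun t => a (p.1, t) * P (p.1, t))
      (fun t ht => ?_) (Continuous.intervalIntegrable (by fun_prop) _ _)
    exact (hasDerivAt_slice_right (had _)).mul (hPv _ (mem_ball_right_of_mem_uIcc hp ht))
  have e5 : ∀ p : ℝ × ℝ, ∫ s in p₀.1..p.1, (du b (s, p.2) * Pt (s, p.2) +
      b (s, p.2) * (a (s, p.2) * P (s, p.2))) = b p * Pt p - b (p₀.1, p.2) * P (p₀.1, p.2) := by
    intro p
    have := intervalIntegral.integral_eq_sub_of_hasDerivAt (a := p₀.1) (b := p.1)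
      (f := fun s => b (s, p.2) * Pt (s, p.2))
      (fun s _ => (hasDerivAt_slice_left (hbd _)).mul (hPtu (s, p.2)))
      (Continuous.intervalIntegrable (by fun_prop) _ _)
    simpa [Pt] using this
  let W (s t : ℝ) : 𝔸 := dv a (s, t) * P (s, t) + a (s, t) * (b (s, t) * P (s, t))
  have hW : Continuous W.uncurry := by simp only [W, Function.uncurry_def]; fun_prop
  -- The defect vanishes on `v = v₀`, so it is the integral of its `v`-derivative; here `W = (a
  -- P)_v`, and Fubini moves the `v`-integral outside.
  have e6 : ∀ p ∈ ball p₀ r, Pt p - P p = ∫ t in p₀.2..p.2, (b (p₀.1, t) * P (p₀.1, t) +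
      (∫ s in p₀.1..p.1, W s t) - b (p.1, t) * P (p.1, t)) := by
    intro p hp
    have hWs : Continuous fun t => ∫ s in p₀.1..p.1, W s t :=
      intervalIntegral.continuous_parametric_intervalIntegral_of_continuous' (f := fun t s => W s t)
        (hW.comp continuous_swap) _ _
    rw [intervalIntegral.integral_sub, intervalIntegral.integral_add,
      ← intervalIntegral_intervalIntegral_swap]
    · have h3 : ∫ s in p₀.1..p.1, ∫ t in p₀.2..p.2, W s t = ∫ s in p₀.1..p.1,
          (a (s, p.2) * P (s, p.2) - a (s, p₀.2) * P (s, p₀.2)) :=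
        intervalIntegral.integral_congr fun s hs => e3 (s, p.2) (mem_ball_left_of_mem_uIcc hp hs)
      rw [h3, intervalIntegral.integral_sub]
      · have h1 := e1 p hp
        have h1' := e1 _ (mem_ball_left_of_mem_uIcc hp left_mem_uIcc)
        have h2 := e2 p hp
        simp only [Pt] at h2 ⊢
        rw [← h2] at h1
        rw [h1]
        nth_rewrite 1 [h1']
        dsimp only
        abel
      · exact Continuous.intervalIntegrable (by fun_prop) _ _
      · exact Continuous.intervalIntegrable (by fun_prop) _ _
    · exact (hW.continuousOn.integrableOn_compact (isCompact_uIcc.prod isCompact_uIcc)).mono_set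
        (prod_mono uIoc_subset_uIcc uIoc_subset_uIcc)
    · exact Continuous.intervalIntegrable (by fun_prop) _ _
    · exact hWs.intervalIntegrable _ _
    · exact (Continuous.add (by fun_prop) hWs).intervalIntegrable _ _
    · exact Continuous.intervalIntegrable (by fun_prop) _ _
  -- Compatibility turns `W` into `b_u P + b a P`, which is `(b Pt)_u - b_u (Pt - P)`. The integrand
  -- of the defect thus depends linearly on the defect alone.
  have e7 : ∀ p ∈ ball p₀ r, b (p₀.1, p.2) * P (p₀.1, p.2) + (∫ s in p₀.1..p.1, W s p.2) - b p * P p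
      = b p * (Pt p - P p) - ∫ s in p₀.1..p.1, du b (s, p.2) * (Pt (s, p.2) - P (s, p.2)) := by
    intro p hp
    have h : ∫ s in p₀.1..p.1, W s p.2 = (∫ s in p₀.1..p.1, (du b (s, p.2) * Pt (s, p.2) +
        b (s, p.2) * (a (s, p.2) * P (s, p.2)))) -
        ∫ s in p₀.1..p.1, du b (s, p.2) * (Pt (s, p.2) - P (s, p.2)) := by
      rw [← intervalIntegral.integral_sub]
      · refine intervalIntegral.integral_congr fun s hs => ?_
        have hc := congrArg (· * P (s, p.2)) (hcomp _ (mem_ball_left_of_mem_uIcc hp hs))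
        simp only [add_mul, mul_assoc] at hc
        simp only [W, hc, mul_sub]
        abel
      · exact Continuous.intervalIntegrable (by fun_prop) _ _
      · exact Continuous.intervalIntegrable (by fun_prop) _ _
    rw [h, e5, mul_sub]
    abel
  obtain ⟨B, hB⟩ := (isCompact_closedBall p₀ r).exists_bound_of_continuousOn
    (f := fun p => Pt p - P p) (hPt.sub hP).continuousOn
  -- The resulting homogeneous Volterra equation improves any bound on the defect by the factor `r
  -- (C + C r) < 1`.
  have key := eq_zero_of_bound_improves (S := ball p₀ r) (f := fun p => Pt p - P p)
    (κ := r * (C + C * r)) (B := B) (by positivity) hrC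
    ((norm_nonneg _).trans (hB p₀ (mem_closedBall_self hr.le)))
    (fun p hp => hB p (ball_subset_closedBall hp)) (fun B hB0 hB p hp => by
      simp only [e6 p hp]
      have hp' := mem_ball_iff_abs.1 hp
      have := intervalIntegral.norm_integral_le_of_norm_le_const (a := p₀.2) (b := p.2)
        (f := fun t => b (p₀.1, t) * P (p₀.1, t) + (∫ s in p₀.1..p.1, W s t) -
          b (p.1, t) * P (p.1, t)) (C := C * B + C * B * r) (fun t ht => by
          have ht' := mem_ball_right_of_mem_uIcc hp (uIoc_subset_uIcc ht)
          rw [e7 (p.1, t) ht']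
          refine (norm_sub_le _ _).trans (add_le_add ?_ ?_)
          · exact (norm_mul_le _ _).trans (mul_le_mul (hbC _) (hB _ ht') (norm_nonneg _) hC0)
          · exact norm_intervalIntegral_mul_le (fun _ => hdbC _)
              (fun s hs => hB _ (mem_ball_left_of_mem_uIcc ht' hs)) hp'.1.le hC0 hB0)
      refine this.trans ?_
      calc (C * B + C * B * r) * |p.2 - p₀.2| ≤ (C * B + C * B * r) * r :=
            mul_le_mul_of_nonneg_left hp'.2.le (by positivity)
        _ = _ := by ring)
  intro p hp
  exact (sub_eq_zero.1 (key p hp)).symm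

theorem hasFDerivAt_of_partials {E : Type*} [NormedAddCommGroup E] [NormedSpace ℝ E]
    {f g h : ℝ × ℝ → E} {D : Set (ℝ × ℝ)} (hD : IsOpen D) (hg : ContinuousOn g D)
    (hh : ContinuousOn h D) (hu : ∀ p ∈ D, HasDerivAt (fun s => f (s, p.2)) (g p) p.1)
    (hv : ∀ p ∈ D, HasDerivAt (fun t => f (p.1, t)) (h p) p.2) {p : ℝ × ℝ} (hp : p ∈ D) :
    HasFDerivAt f ((ContinuousLinearMap.toSpanSingleton ℝ (g p)).coprod
      (ContinuousLinearMap.toSpanSingleton ℝ (h p))) p := by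
  have hn := hD.mem_nhds hp
  refine (hasStrictFDerivAt_uncurry_coprod (f := fun s t => f (s, t))
    (f₁ := fun s t => ContinuousLinearMap.toSpanSingleton ℝ (g (s, t)))
    (f₂ := fun s t => ContinuousLinearMap.toSpanSingleton ℝ (h (s, t))) ?_ ?_ ?_ ?_).hasFDerivAt
  · filter_upwards [hn] with q hq using (hu q hq).hasFDerivAt
  · filter_upwards [hn] with q hq using (hv q hq).hasFDerivAt
  · exact (ContinuousLinearMap.toSpanSingletonCLE (𝕜 := ℝ) (E := E)).continuous.continuousAt.comp
      (hg.continuousAt hn)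
  · exact (ContinuousLinearMap.toSpanSingletonCLE (𝕜 := ℝ) (E := E)).continuous.continuousAt.comp
      (hh.continuousAt hn)

/-- **Frobenius theorem** for linear systems: a compatible system `P_u = a P`, `P_v = b P` with
smooth coefficients has a smooth local solution with `P(p₀) = 1`. -/
theorem exists_solution_linear_system {a b : ℝ × ℝ → 𝔸} {D : Set (ℝ × ℝ)} (hD : IsOpen D)
    (ha : ContDiffOn ℝ ∞ a D) (hb : ContDiffOn ℝ ∞ b D)
    (hcomp : ∀ p ∈ D, dv a p + a p * b p = du b p + b p * a p) {p₀ : ℝ × ℝ} (hp₀ : p₀ ∈ D) :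
    ∃ r > 0, ball p₀ r ⊆ D ∧ ∃ P : ℝ × ℝ → 𝔸, ContDiffOn ℝ ∞ P (ball p₀ r) ∧ P p₀ = 1 ∧
      ∀ p ∈ ball p₀ r, du P p = a p * P p ∧ dv P p = b p * P p := by
  obtain ⟨a', ha', hac, haa⟩ := exists_contDiff_hasCompactSupport_eventuallyEq hD ha hp₀
  obtain ⟨b', hb', hbc, hbb⟩ := exists_contDiff_hasCompactSupport_eventuallyEq hD hb hp₀
  obtain ⟨R, hR, hRs⟩ := Metric.mem_nhds_iff.1 (inter_mem (inter_mem haa hbb) (hD.mem_nhds hp₀))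
  have hRa : EqOn a' a (ball p₀ R) := fun p hp => (hRs hp).1.1
  have hRb : EqOn b' b (ball p₀ R) := fun p hp => (hRs hp).1.2
  have hRD : ball p₀ R ⊆ D := fun p hp => (hRs hp).2
  have hdb : Continuous (du b') := (hb'.continuous_fderiv (by simp)).clm_apply continuous_const
  have hdbc : HasCompactSupport (du b') := hbc.fderiv_apply (𝕜 := ℝ) _
  obtain ⟨C₁, hC₁⟩ := hac.exists_bound_of_continuous ha'.continuous
  obtain ⟨C₂, hC₂⟩ := hbc.exists_bound_of_continuous hb'.continuous
  obtain ⟨C₃, hC₃⟩ := hdbc.exists_bound_of_continuous hdb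
  let C := max C₁ (max C₂ C₃)
  have hC₁' : ∀ p, ‖a' p‖ ≤ C := fun p => (hC₁ p).trans (le_max_left _ _)
  have hC₂' : ∀ p, ‖b' p‖ ≤ C := fun p => (hC₂ p).trans (by simp [C])
  have hC₃' : ∀ p, ‖du b' p‖ ≤ C := fun p => (hC₃ p).trans (by simp [C])
  have hC0 : 0 ≤ C := (norm_nonneg _).trans (hC₁' p₀)
  -- This gives both `2 C r < 1`, for the contraction, and `r ≤ 1`, whence `r (C + C r) ≤ 2 C r < 1`
  -- for the compatibility argument.
  let r := min R (1 / (2 * (C + 1)))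
  have hr : 0 < r := lt_min hR (by positivity)
  have hrR : r ≤ R := min_le_left _ _
  have hrC : 2 * (C * r) < 1 := by
    have h1 : r * (2 * (C + 1)) ≤ 1 := (le_div_iff₀ (by positivity)).1 (min_le_right _ _)
    linarith
  have hr1 : r ≤ 1 := by
    refine (min_le_right _ _).trans ((div_le_one (by positivity)).2 (by linarith))
  obtain ⟨P, hPc, hP⟩ := exists_continuous_integral_solution ha'.continuous hb'.continuous hC0
    hC₁' hC₂' hr.le hrC p₀
  have hP' : ∀ p ∈ ball p₀ r, _ := fun p hp => hP p (ball_subset_closedBall hp)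
  have hrs := ball_subset_ball (x := p₀) hrR
  have hac' := ha'.continuous
  have hbc' := hb'.continuous
  have hu := integral_solution_eq ha' hb' hPc hC0 hC₂' hC₃' hr
    (by nlinarith [mul_nonneg hC0 hr.le]) (fun p hp => by
      rw [dv_congr_on isOpen_ball hRa (hrs hp), du_congr_on isOpen_ball hRb (hrs hp),
        hRa (hrs hp), hRb (hrs hp)]
      exact hcomp p (hRD (hrs hp))) hP'
  have hPv : ∀ p ∈ ball p₀ r, HasDerivAt (fun t => P (p.1, t)) (b' p * P p) p.2 := by
    intro p hp
    have h1 : HasDerivAt (fun t => ∫ t in p₀.2..t, b' (p.1, t) * P (p.1, t)) (b' p * P p) p.2 :=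
      (Continuous.integral_hasStrictDerivAt (by fun_prop) p₀.2 p.2).hasDerivAt
    refine (h1.const_add (1 + ∫ s in p₀.1..p.1, a' (s, p₀.2) * P (s, p₀.2))).congr_of_eventuallyEq ?_
    have : ∀ᶠ t in 𝓝 p.2, (p.1, t) ∈ ball p₀ r :=
      (Continuous.prodMk_right p.1).continuousAt.eventually (isOpen_ball.mem_nhds hp)
    filter_upwards [this] with t ht
    exact hP' _ ht
  have hPu : ∀ p ∈ ball p₀ r, HasDerivAt (fun s => P (s, p.2)) (a' p * P p) p.1 := by
    intro p hp
    have h1 : HasDerivAt (fun s => ∫ s in p₀.1..s, a' (s, p.2) * P (s, p.2)) (a' p * P p) p.1 :=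
      (Continuous.integral_hasStrictDerivAt (by fun_prop) p₀.1 p.1).hasDerivAt
    refine (h1.const_add (P (p₀.1, p.2))).congr_of_eventuallyEq ?_
    have : ∀ᶠ s in 𝓝 p.1, (s, p.2) ∈ ball p₀ r :=
      (Continuous.prodMk_left p.2).continuousAt.eventually (isOpen_ball.mem_nhds hp)
    filter_upwards [this] with t ht
    exact hu _ ht
  have hF : ∀ p ∈ ball p₀ r, HasFDerivAt P ((ContinuousLinearMap.toSpanSingleton ℝ
      (a' p * P p)).coprod (ContinuousLinearMap.toSpanSingleton ℝ (b' p * P p))) p := fun p hp =>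
    hasFDerivAt_of_partials isOpen_ball (by fun_prop) (by fun_prop) hPu hPv hp
  refine ⟨r, hr, hrs.trans hRD, P,
    contDiffOn_of_linear_system isOpen_ball ha'.contDiffOn hb'.contDiffOn hF, ?_, fun p hp => ?_⟩
  · simpa using hP p₀ (mem_closedBall_self hr.le)
  · rw [du, dv, (hF p hp).fderiv, ← hRa (hrs hp), ← hRb (hrs hp)]
    simp

end Frobenius

/-! ### Differentiation rules for `du` and `dv`. -/

section Rules

variable {E : Type*} [NormedAddCommGroup E] [NormedSpace ℝ E] {p w : ℝ × ℝ}

theorem fderiv_pi_apply {ι : Type*} [Fintype ι] {f : ℝ × ℝ → ι → ℝ}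
    (hf : DifferentiableAt ℝ f p) (i : ι) :
    fderiv ℝ (fun q => f q i) p w = fderiv ℝ f p w i := by
  rw [(hasFDerivAt_pi'.1 hf.hasFDerivAt i).fderiv]; simp

theorem differentiableAt_mink {f g : ℝ × ℝ → Fin 3 → ℝ} (hf : DifferentiableAt ℝ f p)
    (hg : DifferentiableAt ℝ g p) : DifferentiableAt ℝ (fun q => mink (f q) (g q)) p := by
  have hf' := differentiableAt_pi.1 hf
  have hg' := differentiableAt_pi.1 hg
  unfold mink
  fun_prop

theorem contDiffOn_mink {f g : ℝ × ℝ → Fin 3 → ℝ} {D : Set (ℝ × ℝ)} (hf : ContDiffOn ℝ ∞ f D)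
    (hg : ContDiffOn ℝ ∞ g D) : ContDiffOn ℝ ∞ (fun q => mink (f q) (g q)) D := by
  have hf' := contDiffOn_pi.1 hf
  have hg' := contDiffOn_pi.1 hg
  unfold mink
  fun_prop

theorem contDiffOn_cross {f g : ℝ × ℝ → Fin 3 → ℝ} {D : Set (ℝ × ℝ)} (hf : ContDiffOn ℝ ∞ f D)
    (hg : ContDiffOn ℝ ∞ g D) : ContDiffOn ℝ ∞ (fun q => cross (f q) (g q)) D := by
  have hf' := contDiffOn_pi.1 hf
  have hg' := contDiffOn_pi.1 hg
  refine contDiffOn_pi.2 fun i => ?_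
  fin_cases i <;> simp [cross] <;> fun_prop

theorem fderiv_mink {f g : ℝ × ℝ → Fin 3 → ℝ} (hf : DifferentiableAt ℝ f p)
    (hg : DifferentiableAt ℝ g p) : fderiv ℝ (fun q => mink (f q) (g q)) p w =
      mink (fderiv ℝ f p w) (g p) + mink (f p) (fderiv ℝ g p w) := by
  have hf' := hasFDerivAt_pi'.1 hf.hasFDerivAt
  have hg' := hasFDerivAt_pi'.1 hg.hasFDerivAt
  have h := ((((hf' 0).mul (hg' 0)).neg).add ((hf' 1).mul (hg' 1))).add ((hf' 2).mul (hg' 2))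
  have h2 : HasFDerivAt (fun q => mink (f q) (g q)) _ p := h
  rw [h2.fderiv]
  simp [mink]
  ring

theorem du_mink {f g : ℝ × ℝ → Fin 3 → ℝ} (hf : DifferentiableAt ℝ f p)
    (hg : DifferentiableAt ℝ g p) : du (fun q => mink (f q) (g q)) p =
      mink (du f p) (g p) + mink (f p) (du g p) := fderiv_mink hf hg

theorem dv_mink {f g : ℝ × ℝ → Fin 3 → ℝ} (hf : DifferentiableAt ℝ f p)
    (hg : DifferentiableAt ℝ g p) : dv (fun q => mink (f q) (g q)) p =
      mink (dv f p) (g p) + mink (f p) (dv g p) := fderiv_mink hf hg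

theorem fderiv_smul_apply {c : ℝ × ℝ → ℝ} {f : ℝ × ℝ → E} (hc : DifferentiableAt ℝ c p)
    (hf : DifferentiableAt ℝ f p) : fderiv ℝ (fun q => c q • f q) p w =
      fderiv ℝ c p w • f p + c p • fderiv ℝ f p w := by
  rw [fderiv_fun_smul hc hf]; simp [add_comm]

theorem du_smul {c : ℝ × ℝ → ℝ} {f : ℝ × ℝ → E} (hc : DifferentiableAt ℝ c p)
    (hf : DifferentiableAt ℝ f p) : du (fun q => c q • f q) p = du c p • f p + c p • du f p :=
  fderiv_smul_apply hc hf

theorem dv_smul {c : ℝ × ℝ → ℝ} {f : ℝ × ℝ → E} (hc : DifferentiableAt ℝ c p)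
    (hf : DifferentiableAt ℝ f p) : dv (fun q => c q • f q) p = dv c p • f p + c p • dv f p :=
  fderiv_smul_apply hc hf

theorem du_add {f g : ℝ × ℝ → E} (hf : DifferentiableAt ℝ f p) (hg : DifferentiableAt ℝ g p) :
    du (fun q => f q + g q) p = du f p + du g p := by
  simp [du, fderiv_fun_add hf hg]

theorem dv_add {f g : ℝ × ℝ → E} (hf : DifferentiableAt ℝ f p) (hg : DifferentiableAt ℝ g p) :
    dv (fun q => f q + g q) p = dv f p + dv g p := by
  simp [dv, fderiv_fun_add hf hg]

theorem differentiableAt_div {f g : ℝ × ℝ → ℝ} (hf : DifferentiableAt ℝ f p)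
    (hg : DifferentiableAt ℝ g p) (h0 : g p ≠ 0) : DifferentiableAt ℝ (fun q => f q / g q) p := by
  simp only [div_eq_mul_inv]
  exact hf.mul (hg.inv h0)

theorem fderiv_div_apply {f g : ℝ × ℝ → ℝ} (hf : DifferentiableAt ℝ f p)
    (hg : DifferentiableAt ℝ g p) (h0 : g p ≠ 0) : fderiv ℝ (fun q => f q / g q) p w =
      (fderiv ℝ f p w * g p - f p * fderiv ℝ g p w) / g p ^ 2 := by
  have h1 : HasFDerivAt (fun q => (g q)⁻¹) _ p :=
    (hasDerivAt_inv h0).comp_hasFDerivAt p hg.hasFDerivAt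
  have h := (hf.hasFDerivAt.mul h1).fderiv
  have e : (fun q => f q / g q) = f * fun q => (g q)⁻¹ := by
    ext q; simp [div_eq_mul_inv]
  rw [e, h]
  simp
  field_simp
  ring

theorem du_div {f g : ℝ × ℝ → ℝ} (hf : DifferentiableAt ℝ f p)
    (hg : DifferentiableAt ℝ g p) (h0 : g p ≠ 0) : du (fun q => f q / g q) p =
      (du f p * g p - f p * du g p) / g p ^ 2 := fderiv_div_apply hf hg h0

theorem dv_div {f g : ℝ × ℝ → ℝ} (hf : DifferentiableAt ℝ f p)
    (hg : DifferentiableAt ℝ g p) (h0 : g p ≠ 0) : dv (fun q => f q / g q) p =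
      (dv f p * g p - f p * dv g p) / g p ^ 2 := fderiv_div_apply hf hg h0

theorem du_const_mul {f : ℝ × ℝ → ℝ} (hf : DifferentiableAt ℝ f p) (c : ℝ) :
    du (fun q => c * f q) p = c * du f p := by
  simp [du, fderiv_const_mul hf]

theorem dv_const_mul {f : ℝ × ℝ → ℝ} (hf : DifferentiableAt ℝ f p) (c : ℝ) :
    dv (fun q => c * f q) p = c * dv f p := by
  simp [dv, fderiv_const_mul hf]

theorem du_const (c : E) : du (fun _ => c) p = 0 := by simp [du]

theorem dv_const (c : E) : dv (fun _ => c) p = 0 := by simp [dv]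

theorem du_neg_log {f : ℝ × ℝ → ℝ} (hf : DifferentiableAt ℝ f p) (h0 : f p ≠ 0) :
    du (fun q => -Real.log (f q)) p = -1 * (du f p / f p) := by
  have h : HasFDerivAt (fun q => -Real.log (f q)) _ p := (hf.hasFDerivAt.log h0).neg
  rw [du, h.fderiv]
  simp [du]; ring

/-- A function with vanishing `u`-derivative is constant along `u`-segments. -/
theorem eq_of_du_eq_zero {f : ℝ × ℝ → ℝ} {D : Set (ℝ × ℝ)}
    (hf : ∀ q ∈ D, DifferentiableAt ℝ f q) (h : ∀ q ∈ D, du f q = 0) {s₀ s t : ℝ}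
    (hs : ∀ r ∈ uIcc s₀ s, (r, t) ∈ D) : f (s, t) = f (s₀, t) := by
  have := (convex_uIcc s₀ s).norm_image_sub_le_of_norm_hasDerivWithin_le (C := 0)
    (f := fun r => f (r, t)) (f' := fun r => du f (r, t))
    (fun r hr => (hasDerivAt_slice_left (hf _ (hs r hr))).hasDerivWithinAt)
    (fun r hr => by rw [h _ (hs r hr), norm_zero]) left_mem_uIcc right_mem_uIcc
  simpa [sub_eq_zero] using this

/-- A function with vanishing `v`-derivative is constant along `v`-segments. -/
theorem eq_of_dv_eq_zero {f : ℝ × ℝ → ℝ} {D : Set (ℝ × ℝ)}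
    (hf : ∀ q ∈ D, DifferentiableAt ℝ f q) (h : ∀ q ∈ D, dv f q = 0) {s t₀ t : ℝ}
    (hs : ∀ r ∈ uIcc t₀ t, (s, r) ∈ D) : f (s, t) = f (s, t₀) := by
  have := (convex_uIcc t₀ t).norm_image_sub_le_of_norm_hasDerivWithin_le (C := 0)
    (f := fun r => f (s, r)) (f' := fun r => dv f (s, r))
    (fun r hr => (hasDerivAt_slice_right (hf _ (hs r hr))).hasDerivWithinAt)
    (fun r hr => by rw [h _ (hs r hr), norm_zero]) left_mem_uIcc right_mem_uIcc
  simpa [sub_eq_zero] using this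

end Rules

/-! ### Algebra of the Minkowski product and of null frames. -/

section Algebra

theorem mink_comm (a b : Fin 3 → ℝ) : mink a b = mink b a := by simp only [mink]; ring

theorem mink_add_left (a b c : Fin 3 → ℝ) : mink (a + b) c = mink a c + mink b c := by
  simp only [mink, Pi.add_apply]; ring

theorem mink_add_right (a b c : Fin 3 → ℝ) : mink a (b + c) = mink a b + mink a c := by
  simp only [mink, Pi.add_apply]; ring

theorem mink_smul_left (r : ℝ) (a b : Fin 3 → ℝ) : mink (r • a) b = r * mink a b := by
  simp only [mink, Pi.smul_apply, smul_eq_mul]; ring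

theorem mink_smul_right (r : ℝ) (a b : Fin 3 → ℝ) : mink a (r • b) = r * mink a b := by
  simp only [mink, Pi.smul_apply, smul_eq_mul]; ring

theorem mink_cross_left (a b : Fin 3 → ℝ) : mink (cross a b) a = 0 := by
  simp [mink, cross]; ring

theorem mink_cross_right (a b : Fin 3 → ℝ) : mink (cross a b) b = 0 := by
  simp [mink, cross]; ring

theorem mink_cross_cross (a b : Fin 3 → ℝ) :
    mink (cross a b) (cross a b) = mink a b ^ 2 - mink a a * mink b b := by
  simp [mink, cross]; ring

/-- The right side is minus the Gram determinant of `a, b, c`; the sign is the determinant of the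
metric. -/
theorem mink_cross_sq (a b c : Fin 3 → ℝ) : mink (cross a b) c ^ 2 =
    -(mink a a * (mink b b * mink c c - mink b c ^ 2) -
      mink a b * (mink a b * mink c c - mink b c * mink a c) +
      mink a c * (mink a b * mink b c - mink b b * mink a c)) := by
  simp [mink, cross]; ring

/-- Cramer's rule in the reciprocal basis. It shows that a vector orthogonal to three independent
vectors vanishes. -/
theorem mink_cross_smul (a b c w : Fin 3 → ℝ) : mink (cross a b) c • w =
    mink w a • cross b c + mink w b • cross c a + mink w c • cross a b := by
  ext i
  fin_cases i <;> simp [mink, cross] <;> ring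

/-- `X`, `Y` are null vectors with product `F`, and `l` is a unit vector orthogonal to both. -/
structure IsNullFrame (F : ℝ) (X Y l : Fin 3 → ℝ) : Prop where
  XX : mink X X = 0
  YY : mink Y Y = 0
  XY : mink X Y = F
  Xl : mink X l = 0
  Yl : mink Y l = 0
  ll : mink l l = 1

namespace IsNullFrame

variable {F : ℝ} {X Y l : Fin 3 → ℝ}

/-- Since `X` and `Y` are null, the coefficient of each is read off by pairing with the other. The
difference of the two sides is orthogonal to the frame, and the frame is a basis because `det (X, Y,
l)² = F²`. -/
theorem decomp (h : IsNullFrame F X Y l) (hF : F ≠ 0) (w : Fin 3 → ℝ) :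
    w = (mink w Y / F) • X + (mink w X / F) • Y + mink w l • l := by
  have hD : mink (cross X Y) l ≠ 0 := by
    intro h0
    have := mink_cross_sq X Y l
    rw [h0, h.XX, h.YY, h.XY, h.Xl, h.Yl, h.ll] at this
    simp at this
    exact hF this
  have hYX : mink Y X = F := by rw [mink_comm, h.XY]
  have hlX : mink l X = 0 := by rw [mink_comm, h.Xl]
  have hlY : mink l Y = 0 := by rw [mink_comm, h.Yl]
  set z := w + (-1 : ℝ) • ((mink w Y / F) • X + (mink w X / F) • Y + mink w l • l) with hz
  have zX : mink z X = 0 := by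
    simp only [hz, mink_add_left, mink_smul_left, h.XX, hYX, hlX]; field_simp; ring
  have zY : mink z Y = 0 := by
    simp only [hz, mink_add_left, mink_smul_left, h.YY, h.XY, hlY]; field_simp; ring
  have zl : mink z l = 0 := by
    simp only [hz, mink_add_left, mink_smul_left, h.Xl, h.Yl, h.ll]; ring
  have key := mink_cross_smul X Y l z
  rw [zX, zY, zl, zero_smul, zero_smul, zero_smul, add_zero, add_zero] at key
  have k2 := (smul_eq_zero.1 key).resolve_left hD
  rw [hz, neg_one_smul, ← sub_eq_add_neg] at k2
  exact sub_eq_zero.1 k2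

end IsNullFrame

end Algebra

/-- The Gauss-Weingarten equations, in isotropic coordinates with `M = H F`, for the coordinate
fields `X`, `Y` and the unit normal `l`. -/
structure SolvesGaussWeingarten (H : ℝ) (F L N : ℝ × ℝ → ℝ) (X Y l : ℝ × ℝ → Fin 3 → ℝ)
    (D : Set (ℝ × ℝ)) : Prop where
  diffX : ∀ p ∈ D, DifferentiableAt ℝ X p
  diffY : ∀ p ∈ D, DifferentiableAt ℝ Y p
  diffl : ∀ p ∈ D, DifferentiableAt ℝ l p
  X_u : ∀ p ∈ D, du X p = (du F p / F p) • X p + L p • l p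
  X_v : ∀ p ∈ D, dv X p = (H * F p) • l p
  Y_u : ∀ p ∈ D, du Y p = (H * F p) • l p
  Y_v : ∀ p ∈ D, dv Y p = (dv F p / F p) • Y p + N p • l p
  l_u : ∀ p ∈ D, du l p = (-H) • X p + (-(L p / F p)) • Y p
  l_v : ∀ p ∈ D, dv l p = (-(N p / F p)) • X p + (-H) • Y p

/-! ### Gauss-Weingarten, Codazzi and Gauss equations of a surface. -/

section Surface

variable {x : ℝ × ℝ → Fin 3 → ℝ} {D : Set (ℝ × ℝ)} {H : ℝ}

theorem IsIsotropic.sqrt_cross (hI : IsIsotropic x D) {p : ℝ × ℝ} (hp : p ∈ D) :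
    Real.sqrt |mink (cross (du x p) (dv x p)) (cross (du x p) (dv x p))| = coeffF x p := by
  obtain ⟨hE, hG, hF⟩ := hI p hp
  rw [mink_cross_cross]
  change Real.sqrt |coeffF x p ^ 2 - coeffE x p * coeffG x p| = _
  rw [hE, zero_mul, sub_zero, abs_of_nonneg (sq_nonneg _), Real.sqrt_sq hF.le]

theorem IsIsotropic.normal_eq (hI : IsIsotropic x D) {p : ℝ × ℝ} (hp : p ∈ D) :
    normal x p = (coeffF x p)⁻¹ • cross (du x p) (dv x p) := by
  rw [normal, hI.sqrt_cross hp]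

theorem IsIsotropic.isNullFrame (hI : IsIsotropic x D) {p : ℝ × ℝ} (hp : p ∈ D) :
    IsNullFrame (coeffF x p) (du x p) (dv x p) (normal x p) := by
  obtain ⟨hE, hG, hF⟩ := hI p hp
  refine ⟨hE, hG, rfl, ?_, ?_, ?_⟩
  · rw [hI.normal_eq hp, mink_smul_right, mink_comm, mink_cross_left, mul_zero]
  · rw [hI.normal_eq hp, mink_smul_right, mink_comm, mink_cross_right, mul_zero]
  · rw [hI.normal_eq hp, mink_smul_right, mink_smul_left, mink_cross_cross]
    change _ * (_ * (coeffF x p ^ 2 - coeffE x p * coeffG x p)) = 1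
    rw [hE]; field_simp; ring

theorem IsIsotropic.mink_cross_normal (hI : IsIsotropic x D) {p : ℝ × ℝ} (hp : p ∈ D) :
    mink (cross (du x p) (dv x p)) (normal x p) = coeffF x p := by
  obtain ⟨hE, hG, hF⟩ := hI p hp
  rw [hI.normal_eq hp, mink_smul_right, mink_cross_cross]
  change _ * (coeffF x p ^ 2 - coeffE x p * coeffG x p) = _
  rw [hE]; field_simp; ring

theorem IsIsotropic.meanCurv_eq (hI : IsIsotropic x D) {p : ℝ × ℝ} (hp : p ∈ D) :
    meanCurv x p = coeffM x p / coeffF x p := by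
  obtain ⟨hE, hG, hF⟩ := hI p hp
  rw [meanCurv, hE, hG]; field_simp; ring

theorem IsIsotropic.gaussCurv_eq (hI : IsIsotropic x D) {p : ℝ × ℝ} (hp : p ∈ D) :
    gaussCurv x p = (coeffM x p ^ 2 - coeffL x p * coeffN x p) / coeffF x p ^ 2 := by
  obtain ⟨hE, hG, hF⟩ := hI p hp
  rw [gaussCurv, hE, hG]; field_simp; ring

variable (hS : IsLorentzSurface x D) (hI : IsIsotropic x D)
include hS

theorem IsLorentzSurface.contDiffOn_coeffF : ContDiffOn ℝ ∞ (coeffF x) D :=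
  contDiffOn_mink (contDiffOn_du hS.isOpen hS.smooth) (contDiffOn_dv hS.isOpen hS.smooth)

include hI

theorem IsLorentzSurface.contDiffOn_normal : ContDiffOn ℝ ∞ (normal x) D := by
  have h := ((hS.contDiffOn_coeffF).inv fun p hp => (hI p hp).2.2.ne').smul
    (contDiffOn_cross (contDiffOn_du hS.isOpen hS.smooth) (contDiffOn_dv hS.isOpen hS.smooth))
  exact h.congr fun p hp => hI.normal_eq hp

/-- Each derivative is expanded in the null frame by `IsNullFrame.decomp`; the coefficients come
from differentiating the scalar products of the frame vectors, with `M = H F` inserted. -/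
theorem IsLorentzSurface.solvesGaussWeingarten (hH : ∀ p ∈ D, meanCurv x p = H) :
    SolvesGaussWeingarten H (coeffF x) (coeffL x) (coeffN x) (du x) (dv x) (normal x) D := by
  have hD := hS.isOpen
  have sX := contDiffOn_du hD hS.smooth
  have sY := contDiffOn_dv hD hS.smooth
  have dX : ∀ p ∈ D, DifferentiableAt ℝ (du x) p := fun p hp =>
    (sX.contDiffAt (hD.mem_nhds hp)).differentiableAt (by simp)
  have dY : ∀ p ∈ D, DifferentiableAt ℝ (dv x) p := fun p hp =>
    (sY.contDiffAt (hD.mem_nhds hp)).differentiableAt (by simp)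
  have dl : ∀ p ∈ D, DifferentiableAt ℝ (normal x) p := fun p hp =>
    ((hS.contDiffOn_normal hI).contDiffAt (hD.mem_nhds hp)).differentiableAt (by simp)
  have hcomm : ∀ p ∈ D, dv (du x) p = du (dv x) p := fun p hp =>
    dv_du_comm (hS.smooth.contDiffAt (hD.mem_nhds hp))
  have hM : ∀ p ∈ D, coeffM x p = H * coeffF x p := fun p hp => by
    have h := hI.meanCurv_eq hp
    rw [hH p hp] at h
    rw [h, div_mul_cancel₀ _ (hI p hp).2.2.ne']
  -- derivatives of the relations between the frame vectors
  have cu : ∀ {f g : ℝ × ℝ → Fin 3 → ℝ} {c : ℝ}, (∀ p ∈ D, DifferentiableAt ℝ f p) →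
      (∀ p ∈ D, DifferentiableAt ℝ g p) → (∀ p ∈ D, mink (f p) (g p) = c) → ∀ p ∈ D,
      mink (du f p) (g p) = -mink (f p) (du g p) ∧
      mink (dv f p) (g p) = -mink (f p) (dv g p) := by
    intro f g c hf hg hc p hp
    have e1 := du_congr_on hD (g := fun _ => c) hc hp
    have e2 := dv_congr_on hD (g := fun _ => c) hc hp
    rw [du_mink (hf p hp) (hg p hp), du_const] at e1
    rw [dv_mink (hf p hp) (hg p hp), dv_const] at e2
    exact ⟨by linarith, by linarith⟩
  have fr : ∀ p ∈ D, IsNullFrame (coeffF x p) (du x p) (dv x p) (normal x p) := fun p hp =>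
    hI.isNullFrame hp
  have F0 : ∀ p ∈ D, coeffF x p ≠ 0 := fun p hp => (hI p hp).2.2.ne'
  have hXX := cu dX dX fun p hp => (fr p hp).XX
  have hYY := cu dY dY fun p hp => (fr p hp).YY
  have hll := cu dl dl fun p hp => (fr p hp).ll
  have hXl := cu dl dX fun p hp => (mink_comm _ _).trans (fr p hp).Xl
  have hYl := cu dl dY fun p hp => (mink_comm _ _).trans (fr p hp).Yl
  have XuX : ∀ p ∈ D, mink (du (du x) p) (du x p) = 0 := fun p hp => by
    have := (hXX p hp).1; rw [mink_comm (du x p)] at this; linarith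
  have XvX : ∀ p ∈ D, mink (dv (du x) p) (du x p) = 0 := fun p hp => by
    have := (hXX p hp).2; rw [mink_comm (du x p)] at this; linarith
  have YuY : ∀ p ∈ D, mink (du (dv x) p) (dv x p) = 0 := fun p hp => by
    have := (hYY p hp).1; rw [mink_comm (dv x p)] at this; linarith
  have YvY : ∀ p ∈ D, mink (dv (dv x) p) (dv x p) = 0 := fun p hp => by
    have := (hYY p hp).2; rw [mink_comm (dv x p)] at this; linarith
  have lul : ∀ p ∈ D, mink (du (normal x) p) (normal x p) = 0 := fun p hp => by
    have := (hll p hp).1; rw [mink_comm (normal x p)] at this; linarith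
  have lvl : ∀ p ∈ D, mink (dv (normal x) p) (normal x p) = 0 := fun p hp => by
    have := (hll p hp).2; rw [mink_comm (normal x p)] at this; linarith
  have luX : ∀ p ∈ D, mink (du (normal x) p) (du x p) = -coeffL x p := fun p hp => by
    rw [(hXl p hp).1, mink_comm]; rfl
  have lvX : ∀ p ∈ D, mink (dv (normal x) p) (du x p) = -coeffM x p := fun p hp => by
    rw [(hXl p hp).2, mink_comm]; rfl
  have luY : ∀ p ∈ D, mink (du (normal x) p) (dv x p) = -coeffM x p := fun p hp => by
    rw [(hYl p hp).1, mink_comm, ← hcomm p hp]; rfl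
  have lvY : ∀ p ∈ D, mink (dv (normal x) p) (dv x p) = -coeffN x p := fun p hp => by
    rw [(hYl p hp).2, mink_comm]; rfl
  have Fu : ∀ p ∈ D, du (coeffF x) p = mink (du (du x) p) (dv x p) := fun p hp => by
    have h := du_mink (dX p hp) (dY p hp)
    rw [mink_comm (du x p), ← hcomm p hp, XvX p hp, add_zero] at h
    exact h
  have Fv : ∀ p ∈ D, dv (coeffF x) p = mink (dv (dv x) p) (du x p) := fun p hp => by
    have h := dv_mink (dX p hp) (dY p hp)
    rw [hcomm p hp, YuY p hp, zero_add, mink_comm] at h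
    exact h
  -- `x_uv` is orthogonal to `x_u` because `E = 0` and to `x_v` because `G = 0`, so it is purely
  -- normal.
  have Xvl : ∀ p ∈ D, dv (du x) p = (H * coeffF x p) • normal x p := fun p hp => by
    have h := (fr p hp).decomp (F0 p hp) (dv (du x) p)
    rw [XvX p hp, hcomm p hp, YuY p hp, ← hcomm p hp] at h
    rw [zero_div, zero_smul, zero_smul, zero_add, zero_add] at h
    rw [← hM p hp]
    exact h
  refine ⟨dX, dY, dl, fun p hp => ?_, Xvl, fun p hp => ?_, fun p hp => ?_, fun p hp => ?_,
    fun p hp => ?_⟩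
  · have h := (fr p hp).decomp (F0 p hp) (du (du x) p)
    rw [XuX p hp, ← Fu p hp, zero_div, zero_smul, add_zero] at h
    exact h
  · rw [← hcomm p hp]; exact Xvl p hp
  · have h := (fr p hp).decomp (F0 p hp) (dv (dv x) p)
    rw [YvY p hp, ← Fv p hp, zero_div, zero_smul, zero_add] at h
    exact h
  · have h := (fr p hp).decomp (F0 p hp) (du (normal x) p)
    have h0 := F0 p hp
    rw [lul p hp, luX p hp, luY p hp, hM p hp, zero_smul, add_zero] at h
    rw [h]; congr 2 <;> field_simp
  · have h := (fr p hp).decomp (F0 p hp) (dv (normal x) p)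
    have h0 := F0 p hp
    rw [lvl p hp, lvX p hp, lvY p hp, hM p hp, zero_smul, add_zero] at h
    rw [h]; congr 2 <;> field_simp

/-- The Codazzi equations. -/
theorem IsLorentzSurface.codazzi (hH : ∀ p ∈ D, meanCurv x p = H) :
    ∀ p ∈ D, dv (coeffL x) p = 0 ∧ du (coeffN x) p = 0 := by
  intro p hp
  have hW := hS.solvesGaussWeingarten hI hH
  have hD := hS.isOpen
  have hn := hD.mem_nhds hp
  have sX := contDiffOn_du hD hS.smooth
  have sY := contDiffOn_dv hD hS.smooth
  have sl := hS.contDiffOn_normal hI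
  have dF : DifferentiableAt ℝ (coeffF x) p :=
    (hS.contDiffOn_coeffF.contDiffAt hn).differentiableAt (by simp)
  have fr := hI.isNullFrame hp
  have F0 : coeffF x p ≠ 0 := (hI p hp).2.2.ne'
  have dXu : DifferentiableAt ℝ (du (du x)) p :=
    ((contDiffOn_du hD sX).contDiffAt hn).differentiableAt (by simp)
  have dYv : DifferentiableAt ℝ (dv (dv x)) p :=
    ((contDiffOn_dv hD sY).contDiffAt hn).differentiableAt (by simp)
  have dHF : DifferentiableAt ℝ (fun q => H * coeffF x q) p := dF.const_mul H
  have lX : mink (normal x p) (du x p) = 0 := by rw [mink_comm, fr.Xl]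
  have lY : mink (normal x p) (dv x p) = 0 := by rw [mink_comm, fr.Yl]
  constructor
  -- `L_v = ⟨x_uuv, l⟩ + ⟨x_uu, l_v⟩`. With `x_uuv = (H F l)_u` and `H` constant, the two terms are
  -- `H F_u` and `-H F_u`.
  · have h := dv_mink dXu (hW.diffl p hp)
    rw [dv_du_comm (sX.contDiffAt hn), du_congr_on hD hW.X_v hp, du_smul dHF (hW.diffl p hp),
      du_const_mul dF, hW.l_u p hp, hW.l_v p hp, hW.X_u p hp] at h
    simp only [mink_add_left, mink_add_right, mink_smul_left, mink_smul_right, fr.Xl, fr.Yl, fr.ll,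
      fr.XX, fr.XY, lX, lY] at h
    refine (show dv (coeffL x) p = _ from h).trans ?_
    field_simp; ring
  · have h := du_mink dYv (hW.diffl p hp)
    rw [← dv_du_comm (sY.contDiffAt hn), dv_congr_on hD hW.Y_u hp, dv_smul dHF (hW.diffl p hp),
      dv_const_mul dF, hW.l_u p hp, hW.l_v p hp, hW.Y_v p hp] at h
    have YX : mink (dv x p) (du x p) = coeffF x p := by rw [mink_comm, fr.XY]
    simp only [mink_add_left, mink_add_right, mink_smul_left, mink_smul_right, fr.Xl, fr.Yl, fr.ll,
      fr.YY, YX, lX, lY] at h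
    refine (show du (coeffN x) p = _ from h).trans ?_
    field_simp; ring

/-- The Gauss equation. -/
theorem IsLorentzSurface.gauss (hH : ∀ p ∈ D, meanCurv x p = H) :
    ∀ p ∈ D, dv (fun q => du (coeffF x) q / coeffF x q) p = -(gaussCurv x p * coeffF x p) := by
  intro p hp
  have hW := hS.solvesGaussWeingarten hI hH
  have hD := hS.isOpen
  have hn := hD.mem_nhds hp
  have sX := contDiffOn_du hD hS.smooth
  have sY := contDiffOn_dv hD hS.smooth
  have sF := hS.contDiffOn_coeffF
  have dF : DifferentiableAt ℝ (coeffF x) p := (sF.contDiffAt hn).differentiableAt (by simp)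
  have dFu : DifferentiableAt ℝ (du (coeffF x)) p :=
    ((contDiffOn_du hD sF).contDiffAt hn).differentiableAt (by simp)
  have fr := hI.isNullFrame hp
  have F0 : coeffF x p ≠ 0 := (hI p hp).2.2.ne'
  have dXu : DifferentiableAt ℝ (du (du x)) p :=
    ((contDiffOn_du hD sX).contDiffAt hn).differentiableAt (by simp)
  have dHF : DifferentiableAt ℝ (fun q => H * coeffF x q) p := dF.const_mul H
  have lY : mink (normal x p) (dv x p) = 0 := by rw [mink_comm, fr.Yl]
  have hFu : EqOn (du (coeffF x)) (fun q => mink (du (du x) q) (dv x q)) D := fun q hq => by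
    have h := du_mink (hW.diffX q hq) (hW.diffY q hq)
    rw [hW.Y_u q hq, mink_smul_right, (hI.isNullFrame hq).Xl, mul_zero, add_zero] at h
    exact h
  -- `F_uv = ⟨x_uuv, x_v⟩ + ⟨x_uu, x_vv⟩`: the first term is `H F ⟨l_u, x_v⟩ = -(H F)²`, and the
  -- second is expanded in the frame.
  have hFuv : dv (du (coeffF x)) p = -(H * coeffF x p) ^ 2 +
      (du (coeffF x) p * dv (coeffF x) p / coeffF x p + coeffL x p * coeffN x p) := by
    rw [dv_congr_on hD hFu hp, dv_mink dXu (hW.diffY p hp),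
      dv_du_comm (sX.contDiffAt hn), du_congr_on hD hW.X_v hp, du_smul dHF (hW.diffl p hp),
      hW.l_u p hp, hW.X_u p hp, hW.Y_v p hp]
    simp only [mink_add_left, mink_add_right, mink_smul_left, mink_smul_right, fr.Xl, fr.ll,
      fr.XY, fr.YY, lY]
    field_simp; ring
  have hM : coeffM x p = H * coeffF x p := by
    have h := hI.meanCurv_eq hp
    rw [hH p hp] at h
    rw [h, div_mul_cancel₀ _ F0]
  rw [dv_div dFu dF F0, hFuv, hI.gaussCurv_eq hp, hM]
  field_simp
  ring

end Surface

/-! ### Canonical coordinates and the natural equation. -/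

namespace IsCanonicalCMC

variable {x : ℝ × ℝ → Fin 3 → ℝ} {D : Set (ℝ × ℝ)} {p₀ : ℝ × ℝ} {ε₁ ε₂ H : ℝ}

/-- By Codazzi `L` does not change along `v`-segments, and admissibility of `D` supplies such a
segment from each point to the line `v = v₀`, where `L` is normalized. -/
theorem coeffL_eq (h : IsCanonicalCMC x D p₀ ε₁ ε₂ H) (hD : IsCoordStar D p₀) :
    ∀ p ∈ D, coeffL x p = ε₁ := by
  intro p hp
  have hI := h.canonical.isotropic
  have sL : ContDiffOn ℝ ∞ (coeffL x) D := contDiffOn_mink (contDiffOn_du h.surface.isOpen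
    (contDiffOn_du h.surface.isOpen h.surface.smooth)) (h.surface.contDiffOn_normal hI)
  rw [← h.canonical.L_eq p.1 ((hD.2 p hp).2 _ left_mem_uIcc)]
  exact eq_of_dv_eq_zero (fun q hq => (sL.contDiffAt
    (h.surface.isOpen.mem_nhds hq)).differentiableAt (by simp))
    (fun q hq => (h.surface.codazzi hI h.mean q hq).1) (hD.2 p hp).2

theorem coeffN_eq (h : IsCanonicalCMC x D p₀ ε₁ ε₂ H) (hD : IsCoordStar D p₀) :
    ∀ p ∈ D, coeffN x p = ε₂ := by
  intro p hp
  have hI := h.canonical.isotropic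
  have sN : ContDiffOn ℝ ∞ (coeffN x) D := contDiffOn_mink (contDiffOn_dv h.surface.isOpen
    (contDiffOn_dv h.surface.isOpen h.surface.smooth)) (h.surface.contDiffOn_normal hI)
  rw [← h.canonical.N_eq p.2 ((hD.2 p hp).1 _ left_mem_uIcc)]
  exact eq_of_du_eq_zero (fun q hq => (sN.contDiffAt
    (h.surface.isOpen.mem_nhds hq)).differentiableAt (by simp))
    (fun q hq => (h.surface.codazzi hI h.mean q hq).2) (hD.2 p hp).1

theorem sq_sub_gaussCurv (h : IsCanonicalCMC x D p₀ ε₁ ε₂ H) (hD : IsCoordStar D p₀) :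
    ∀ p ∈ D, H ^ 2 - gaussCurv x p = ε₁ * ε₂ / coeffF x p ^ 2 := by
  intro p hp
  have hI := h.canonical.isotropic
  have F0 : coeffF x p ≠ 0 := (hI p hp).2.2.ne'
  have hM := hI.meanCurv_eq hp
  rw [h.mean p hp] at hM
  rw [hI.gaussCurv_eq hp, h.coeffL_eq hD p hp, h.coeffN_eq hD p hp, hM]
  field_simp
  ring

theorem abs_sign_mul (h : IsCanonicalCMC x D p₀ ε₁ ε₂ H) : |ε₁ * ε₂| = 1 := by
  rcases h.canonical.sign₁ with h1 | h1 <;> rcases h.canonical.sign₂ with h2 | h2 <;>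
    simp [h1, h2]

/-- The curvature alone determines `F`. This converts the Gauss equation into the natural equation
and also underlies uniqueness. -/
theorem sqrt_abs_eq (h : IsCanonicalCMC x D p₀ ε₁ ε₂ H) (hD : IsCoordStar D p₀) :
    ∀ p ∈ D, Real.sqrt |H ^ 2 - gaussCurv x p| = (coeffF x p)⁻¹ := by
  intro p hp
  have F0 : 0 < coeffF x p := (h.canonical.isotropic p hp).2.2
  rw [h.sq_sub_gaussCurv hD p hp, abs_div, h.abs_sign_mul, abs_of_pos (by positivity),
    Real.sqrt_div zero_le_one, Real.sqrt_one, Real.sqrt_sq F0.le, one_div]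

theorem naturalEq (h : IsCanonicalCMC x D p₀ ε₁ ε₂ H) (hD : IsCoordStar D p₀) :
    NaturalEq H (gaussCurv x) D := by
  intro p hp
  have hO := h.surface.isOpen
  have sF := h.surface.contDiffOn_coeffF
  have dF : ∀ q ∈ D, DifferentiableAt ℝ (coeffF x) q := fun q hq =>
    (sF.contDiffAt (hO.mem_nhds hq)).differentiableAt (by simp)
  have F0 : ∀ q ∈ D, coeffF x q ≠ 0 := fun q hq => (h.canonical.isotropic q hq).2.2.ne'
  have dFu : DifferentiableAt ℝ (du (coeffF x)) p :=
    ((contDiffOn_du hO sF).contDiffAt (hO.mem_nhds hp)).differentiableAt (by simp)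
  refine ⟨by rw [← h.mean p hp]; exact h.generalType p hp, ?_⟩
  have e1 : EqOn (fun q => Real.log (Real.sqrt |H ^ 2 - gaussCurv x q|))
      (fun q => -Real.log (coeffF x q)) D := fun q hq => by
    simp only [h.sqrt_abs_eq hD q hq, Real.log_inv]
  have e2 : EqOn (du fun q => Real.log (Real.sqrt |H ^ 2 - gaussCurv x q|))
      (fun q => -1 * (du (coeffF x) q / coeffF x q)) D := fun q hq => by
    rw [du_congr_on hO e1 hq, du_neg_log (dF q hq) (F0 q hq)]
  rw [dv_congr_on hO e2 hp, dv_const_mul (differentiableAt_div dFu (dF p hp) (F0 p hp)),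
    h.surface.gauss h.canonical.isotropic h.mean p hp, h.sqrt_abs_eq hD p hp]
  have := F0 p hp
  field_simp

end IsCanonicalCMC

/-! ### Further differentiation rules. -/

section Rules

variable {p w : ℝ × ℝ}

theorem fderiv_mul_apply {f g : ℝ × ℝ → ℝ} (hf : DifferentiableAt ℝ f p)
    (hg : DifferentiableAt ℝ g p) : fderiv ℝ (fun q => f q * g q) p w =
      fderiv ℝ f p w * g p + f p * fderiv ℝ g p w := by
  rw [fderiv_fun_mul hf hg]; simp; ring

theorem fderiv_add_apply {f g : ℝ × ℝ → ℝ} (hf : DifferentiableAt ℝ f p)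
    (hg : DifferentiableAt ℝ g p) : fderiv ℝ (fun q => f q + g q) p w =
      fderiv ℝ f p w + fderiv ℝ g p w := by
  rw [fderiv_fun_add hf hg]; simp

theorem fderiv_mulVec_add {n : ℕ} (A : Matrix (Fin 3) (Fin n) ℝ) (b : Fin 3 → ℝ)
    {f : ℝ × ℝ → Fin n → ℝ} (hf : DifferentiableAt ℝ f p) :
    HasFDerivAt (fun q => A.mulVec (f q) + b)
      ((A.mulVecLin.toContinuousLinearMap).comp (fderiv ℝ f p)) p :=
  ((A.mulVecLin.toContinuousLinearMap.hasFDerivAt).comp p hf.hasFDerivAt).add_const b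

theorem du_mulVec_add (A : Matrix (Fin 3) (Fin 3) ℝ) (b : Fin 3 → ℝ)
    {f : ℝ × ℝ → Fin 3 → ℝ} (hf : DifferentiableAt ℝ f p) :
    du (fun q => A.mulVec (f q) + b) p = A.mulVec (du f p) := by
  rw [du, (fderiv_mulVec_add A b hf).fderiv]; rfl

theorem dv_mulVec_add (A : Matrix (Fin 3) (Fin 3) ℝ) (b : Fin 3 → ℝ)
    {f : ℝ × ℝ → Fin 3 → ℝ} (hf : DifferentiableAt ℝ f p) :
    dv (fun q => A.mulVec (f q) + b) p = A.mulVec (dv f p) := by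
  rw [dv, (fderiv_mulVec_add A b hf).fderiv]; rfl

end Rules

/-! ### Invariance under proper motions. -/

section Motions

variable {A : Matrix (Fin 3) (Fin 3) ℝ}

theorem det_mulVec (A : Matrix (Fin 3) (Fin 3) ℝ) (a b c : Fin 3 → ℝ) :
    Matrix.det (Matrix.of ![A.mulVec a, A.mulVec b, A.mulVec c]) =
      A.det * Matrix.det (Matrix.of ![a, b, c]) := by
  have : Matrix.of ![A.mulVec a, A.mulVec b, A.mulVec c] = Matrix.of ![a, b, c] * A.transpose := by
    ext i j
    fin_cases i <;> simp [Matrix.mul_apply, Matrix.mulVec, dotProduct, mul_comm]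
  rw [this, Matrix.det_mul, Matrix.det_transpose, mul_comm]

theorem eq_zero_of_mink_eq_zero {z : Fin 3 → ℝ} (h : ∀ w, mink z w = 0) : z = 0 := by
  have h0 := h ![1, 0, 0]
  have h1 := h ![0, 1, 0]
  have h2 := h ![0, 0, 1]
  simp [mink] at h0 h1 h2
  ext i
  fin_cases i <;> simp [h0, h1, h2]

/-- Both sides have the same product with every `A w`, namely `det (a, b, w)`; these vectors exhaust
the space and the product is nondegenerate. With determinant one, the unit normal is carried to the
unit normal without a change of sign. -/
theorem cross_mulVec (hA : ∀ a c, mink (A.mulVec a) (A.mulVec c) = mink a c) (hdet : A.det = 1)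
    (a b : Fin 3 → ℝ) : cross (A.mulVec a) (A.mulVec b) = A.mulVec (cross a b) := by
  rw [← sub_eq_zero]
  refine eq_zero_of_mink_eq_zero fun w => ?_
  have hw : A.mulVec (A⁻¹.mulVec w) = w := by
    rw [Matrix.mulVec_mulVec, Matrix.mul_nonsing_inv _ (by rw [hdet]; exact isUnit_one),
      Matrix.one_mulVec]
  rw [← hw, sub_eq_add_neg, mink_add_left, ← neg_one_smul ℝ, mink_smul_left, hA, mink_cross,
    mink_cross, det_mulVec, hdet]
  ring

/-- The fundamental forms are invariant under proper motions. -/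
theorem ProperlyCongruent.coeff_eq {x y : ℝ × ℝ → Fin 3 → ℝ} {D : Set (ℝ × ℝ)}
    (hS : IsLorentzSurface x D) (h : ProperlyCongruent x y D) : ∀ p ∈ D,
      coeffE y p = coeffE x p ∧ coeffF y p = coeffF x p ∧ coeffG y p = coeffG x p ∧
      coeffL y p = coeffL x p ∧ coeffM y p = coeffM x p ∧ coeffN y p = coeffN x p := by
  obtain ⟨A, b, hA, hdet, hy⟩ := h
  have hD := hS.isOpen
  have sX := contDiffOn_du hD hS.smooth
  have sY := contDiffOn_dv hD hS.smooth
  have eX : EqOn (du y) (fun q => A.mulVec (du x q) + 0) D := fun q hq => by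
    rw [du_congr_on hD hy hq, du_mulVec_add A b
      ((hS.smooth.contDiffAt (hD.mem_nhds hq)).differentiableAt (by simp))]
    exact (add_zero _).symm
  have eY : EqOn (dv y) (fun q => A.mulVec (dv x q) + 0) D := fun q hq => by
    rw [dv_congr_on hD hy hq, dv_mulVec_add A b
      ((hS.smooth.contDiffAt (hD.mem_nhds hq)).differentiableAt (by simp))]
    exact (add_zero _).symm
  intro p hp
  have dX : DifferentiableAt ℝ (du x) p :=
    (sX.contDiffAt (hD.mem_nhds hp)).differentiableAt (by simp)
  have dY : DifferentiableAt ℝ (dv x) p :=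
    (sY.contDiffAt (hD.mem_nhds hp)).differentiableAt (by simp)
  have X1 : du y p = A.mulVec (du x p) := by simpa using eX hp
  have Y1 : dv y p = A.mulVec (dv x p) := by simpa using eY hp
  have n1 : normal y p = A.mulVec (normal x p) := by
    rw [normal, normal, X1, Y1, cross_mulVec hA hdet, hA, Matrix.mulVec_smul]
  have XX : du (du y) p = A.mulVec (du (du x) p) := by
    rw [du_congr_on hD eX hp, du_mulVec_add A 0 dX]
  have XY : dv (du y) p = A.mulVec (dv (du x) p) := by
    rw [dv_congr_on hD eX hp, dv_mulVec_add A 0 dX]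
  have YY : dv (dv y) p = A.mulVec (dv (dv x) p) := by
    rw [dv_congr_on hD eY hp, dv_mulVec_add A 0 dY]
  simp only [coeffE, coeffF, coeffG, coeffL, coeffM, coeffN, X1, Y1, n1, XX, XY, YY, hA, and_self]

theorem ProperlyCongruent.curv_eq {x y : ℝ × ℝ → Fin 3 → ℝ} {D : Set (ℝ × ℝ)}
    (hS : IsLorentzSurface x D) (h : ProperlyCongruent x y D) : ∀ p ∈ D,
      gaussCurv y p = gaussCurv x p ∧ meanCurv y p = meanCurv x p := by
  intro p hp
  obtain ⟨hE, hF, hG, hL, hM, hN⟩ := h.coeff_eq hS p hp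
  simp only [gaussCurv, meanCurv, hE, hF, hG, hL, hM, hN, and_self]

theorem IsCanonicalCMC.of_properlyCongruent {x y : ℝ × ℝ → Fin 3 → ℝ} {D : Set (ℝ × ℝ)}
    {p₀ : ℝ × ℝ} {ε₁ ε₂ H : ℝ} (hx : IsCanonicalCMC x D p₀ ε₁ ε₂ H)
    (h : ProperlyCongruent x y D) : IsCanonicalCMC y D p₀ ε₁ ε₂ H := by
  have hc := h.coeff_eq hx.surface
  have hk := h.curv_eq hx.surface
  refine ⟨⟨hx.surface.isOpen, ?_, fun p hp => ?_⟩, fun p hp => ?_, ⟨fun p hp => ?_,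
    hx.canonical.mem, hx.canonical.sign₁, hx.canonical.sign₂, fun u hu => ?_, fun v hv => ?_⟩,
    fun p hp => ?_⟩
  · obtain ⟨A, b, -, -, hy⟩ := h
    have : ContDiffOn ℝ ∞ (fun q => A.mulVecLin.toContinuousLinearMap (x q) + b) D :=
      (A.mulVecLin.toContinuousLinearMap.contDiff.comp_contDiffOn hx.surface.smooth).add
        contDiffOn_const
    exact this.congr hy
  · rw [(hc p hp).1, (hc p hp).2.1, (hc p hp).2.2.1]; exact hx.surface.lorentz p hp
  · rw [(hk p hp).1, (hk p hp).2]; exact hx.generalType p hp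
  · rw [(hc p hp).1, (hc p hp).2.1, (hc p hp).2.2.1]; exact hx.canonical.isotropic p hp
  · rw [(hc _ hu).2.2.2.1]; exact hx.canonical.L_eq u hu
  · rw [(hc _ hv).2.2.2.2.2]; exact hx.canonical.N_eq v hv
  · rw [(hk p hp).2]; exact hx.mean p hp

end Motions

/-! ### Uniqueness up to proper motion. -/

section Uniqueness

theorem IsCoordStar.isPreconnected {D : Set (ℝ × ℝ)} {p₀ : ℝ × ℝ} (h : IsCoordStar D p₀) :
    IsPreconnected D := by
  refine isPreconnected_of_forall p₀ fun p hp => ?_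
  have hq : (p₀.1, p.2) ∈ D := (h.2 p hp).1 _ left_mem_uIcc
  -- An L-shaped path with corner `(u₀, v)`; the second leg is in `D` because the corner is itself a
  -- point of `D`.
  refine ⟨((fun s => (s, p.2)) '' uIcc p₀.1 p.1) ∪ ((fun t => (p₀.1, t)) '' uIcc p₀.2 p.2),
    ?_, ?_, ?_, ?_⟩
  · rintro _ (⟨s, hs, rfl⟩ | ⟨t, ht, rfl⟩)
    · exact (h.2 p hp).1 s hs
    · exact (h.2 _ hq).2 t ht
  · exact Or.inr ⟨p₀.2, left_mem_uIcc, rfl⟩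
  · exact Or.inl ⟨p.1, right_mem_uIcc, rfl⟩
  · exact IsPreconnected.union (p₀.1, p.2) ⟨p₀.1, left_mem_uIcc, rfl⟩ ⟨p.2, right_mem_uIcc, rfl⟩
      (isPreconnected_uIcc.image _ (by fun_prop)) (isPreconnected_uIcc.image _ (by fun_prop))

theorem eqOn_const_of_du_dv_eq_zero {E : Type*} [NormedAddCommGroup E] [NormedSpace ℝ E]
    {f : ℝ × ℝ → E} {D : Set (ℝ × ℝ)} (hD : IsOpen D) (hc : IsPreconnected D)
    (hf : ∀ p ∈ D, DifferentiableAt ℝ f p) (hu : ∀ p ∈ D, du f p = 0)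
    (hv : ∀ p ∈ D, dv f p = 0) {p q : ℝ × ℝ} (hp : p ∈ D) (hq : q ∈ D) : f p = f q :=
  hD.is_const_of_fderiv_eq_zero hc (fun p hp => (hf p hp).differentiableWithinAt)
    (fun p hp => fderiv_eq_zero_of_du_dv (hu p hp) (hv p hp)) hp hq

/-- The components of `(X' ⊗ Y + Y' ⊗ X) / F + l' ⊗ l`. -/
def frameTensor (F : ℝ × ℝ → ℝ) (X' Y' l' X Y l : ℝ × ℝ → Fin 3 → ℝ) (i j : Fin 3)
    (p : ℝ × ℝ) : ℝ :=
  (X' p i * Y p j + Y' p i * X p j) / F p + l' p i * l p j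

variable {H : ℝ} {F L N : ℝ × ℝ → ℝ} {X Y l X' Y' l' : ℝ × ℝ → Fin 3 → ℝ} {D : Set (ℝ × ℝ)}

theorem SolvesGaussWeingarten.congr {F' L' N' : ℝ × ℝ → ℝ}
    (h : SolvesGaussWeingarten H F L N X Y l D) (hD : IsOpen D) (hF : EqOn F F' D)
    (hL : EqOn L L' D) (hN : EqOn N N' D) : SolvesGaussWeingarten H F' L' N' X Y l D where
  diffX := h.diffX
  diffY := h.diffY
  diffl := h.diffl
  X_u p hp := by rw [← du_congr_on hD hF hp, ← hF hp, ← hL hp]; exact h.X_u p hp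
  X_v p hp := by rw [← hF hp]; exact h.X_v p hp
  Y_u p hp := by rw [← hF hp]; exact h.Y_u p hp
  Y_v p hp := by rw [← dv_congr_on hD hF hp, ← hF hp, ← hN hp]; exact h.Y_v p hp
  l_u p hp := by rw [← hF hp, ← hL hp]; exact h.l_u p hp
  l_v p hp := by rw [← hF hp, ← hN hp]; exact h.l_v p hp

/-- For two solutions of the same Gauss-Weingarten equations the frame tensor is constant. -/
theorem SolvesGaussWeingarten.frameTensor_eq (hD : IsOpen D) (hc : IsPreconnected D)
    (hF : ∀ p ∈ D, DifferentiableAt ℝ F p) (hF0 : ∀ p ∈ D, F p ≠ 0)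
    (h' : SolvesGaussWeingarten H F L N X' Y' l' D) (h : SolvesGaussWeingarten H F L N X Y l D)
    (i j : Fin 3) {p q : ℝ × ℝ} (hp : p ∈ D) (hq : q ∈ D) :
    frameTensor F X' Y' l' X Y l i j p = frameTensor F X' Y' l' X Y l i j q := by
  have dc : ∀ {f : ℝ × ℝ → Fin 3 → ℝ} {p}, DifferentiableAt ℝ f p → ∀ i,
      DifferentiableAt ℝ (fun q => f q i) p := fun hf i => differentiableAt_pi.1 hf i
  have d4 : ∀ p ∈ D, DifferentiableAt ℝ (fun q => X' q i * Y q j) p :=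
    fun p hp => (dc (h'.diffX p hp) i).mul (dc (h.diffY p hp) j)
  have d5 : ∀ p ∈ D, DifferentiableAt ℝ (fun q => Y' q i * X q j) p :=
    fun p hp => (dc (h'.diffY p hp) i).mul (dc (h.diffX p hp) j)
  have d1 : ∀ p ∈ D, DifferentiableAt ℝ (fun q => X' q i * Y q j + Y' q i * X q j) p :=
    fun p hp => (d4 p hp).add (d5 p hp)
  have d2 : ∀ p ∈ D, DifferentiableAt ℝ (fun q => l' q i * l q j) p :=
    fun p hp => (dc (h'.diffl p hp) i).mul (dc (h.diffl p hp) j)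
  have d3 : ∀ p ∈ D, DifferentiableAt ℝ
      (fun q => (X' q i * Y q j + Y' q i * X q j) / F q) p := fun p hp =>
    differentiableAt_div (d1 p hp) (hF p hp) (hF0 p hp)
  have key : ∀ p ∈ D, ∀ w, fderiv ℝ (frameTensor F X' Y' l' X Y l i j) p w =
      ((fderiv ℝ X' p w i * Y p j + X' p i * fderiv ℝ Y p w j + (fderiv ℝ Y' p w i * X p j +
        Y' p i * fderiv ℝ X p w j)) * F p -
        (X' p i * Y p j + Y' p i * X p j) * fderiv ℝ F p w) / F p ^ 2 +
        (fderiv ℝ l' p w i * l p j + l' p i * fderiv ℝ l p w j) := by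
    intro p hp w
    have e := fderiv_add_apply (w := w) (d3 p hp) (d2 p hp)
    rw [fderiv_div_apply (d1 p hp) (hF p hp) (hF0 p hp),
      fderiv_add_apply (d4 p hp) (d5 p hp),
      fderiv_mul_apply (dc (h'.diffX p hp) i) (dc (h.diffY p hp) j),
      fderiv_mul_apply (dc (h'.diffY p hp) i) (dc (h.diffX p hp) j),
      fderiv_mul_apply (dc (h'.diffl p hp) i) (dc (h.diffl p hp) j),
      fderiv_pi_apply (h'.diffX p hp), fderiv_pi_apply (h.diffX p hp),
      fderiv_pi_apply (h'.diffY p hp), fderiv_pi_apply (h.diffY p hp),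
      fderiv_pi_apply (h'.diffl p hp), fderiv_pi_apply (h.diffl p hp)] at e
    exact e
  -- Dividing by `F` absorbs the terms in `F_u`, `F_v`; the remaining terms in `H`, `L`, `N` cancel
  -- between the tangential part and `l' ⊗ l`.
  refine eqOn_const_of_du_dv_eq_zero (f := frameTensor F X' Y' l' X Y l i j) hD hc
    (fun p hp => (d3 p hp).add (d2 p hp))
    (fun p hp => ?_) (fun p hp => ?_) hp hq
  · have e := key p hp (1, 0)
    have a1 := congrFun (h.X_u p hp) j
    have a2 := congrFun (h.Y_u p hp) j
    have a3 := congrFun (h.l_u p hp) j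
    have a4 := congrFun (h'.X_u p hp) i
    have a5 := congrFun (h'.Y_u p hp) i
    have a6 := congrFun (h'.l_u p hp) i
    simp only [du, Pi.add_apply, Pi.smul_apply, smul_eq_mul] at a1 a2 a3 a4 a5 a6
    rw [du, e, a1, a2, a3, a4, a5, a6]
    have := hF0 p hp
    field_simp
    ring
  · have e := key p hp (0, 1)
    have a1 := congrFun (h.X_v p hp) j
    have a2 := congrFun (h.Y_v p hp) j
    have a3 := congrFun (h.l_v p hp) j
    have a4 := congrFun (h'.X_v p hp) i
    have a5 := congrFun (h'.Y_v p hp) i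
    have a6 := congrFun (h'.l_v p hp) i
    simp only [dv, Pi.add_apply, Pi.smul_apply, smul_eq_mul] at a1 a2 a3 a4 a5 a6
    rw [dv, e, a1, a2, a3, a4, a5, a6]
    have := hF0 p hp
    field_simp
    ring

theorem IsNullFrame.mink_comb {F : ℝ} {X Y l : Fin 3 → ℝ} (h : IsNullFrame F X Y l)
    (a b c a' b' c' : ℝ) : mink (a • X + b • Y + c • l) (a' • X + b' • Y + c' • l) =
      (a * b' + b * a') * F + c * c' := by
  have hYX : mink Y X = F := by rw [mink_comm, h.XY]
  have hlX : mink l X = 0 := by rw [mink_comm, h.Xl]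
  have hlY : mink l Y = 0 := by rw [mink_comm, h.Yl]
  simp only [mink_add_left, mink_add_right, mink_smul_left, mink_smul_right, h.XX, h.YY, h.XY,
    h.Xl, h.Yl, h.ll, hYX, hlX, hlY]
  ring

/-- Two oriented frames solving the same Gauss-Weingarten equations differ by a proper
Lorentz transformation. -/
theorem SolvesGaussWeingarten.exists_motion (hD : IsOpen D) (hc : IsPreconnected D)
    (hne : D.Nonempty) (hF : ∀ p ∈ D, DifferentiableAt ℝ F p) (hF0 : ∀ p ∈ D, F p ≠ 0)
    (h : SolvesGaussWeingarten H F L N X Y l D) (h' : SolvesGaussWeingarten H F L N X' Y' l' D)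
    (fr : ∀ p ∈ D, IsNullFrame (F p) (X p) (Y p) (l p))
    (fr' : ∀ p ∈ D, IsNullFrame (F p) (X' p) (Y' p) (l' p))
    (or : ∀ p ∈ D, mink (cross (X p) (Y p)) (l p) = F p)
    (or' : ∀ p ∈ D, mink (cross (X' p) (Y' p)) (l' p) = F p) :
    ∃ A : Matrix (Fin 3) (Fin 3) ℝ,
      (∀ a c : Fin 3 → ℝ, mink (A.mulVec a) (A.mulVec c) = mink a c) ∧ A.det = 1 ∧
      ∀ p ∈ D, A.mulVec (X p) = X' p ∧ A.mulVec (Y p) = Y' p := by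
  obtain ⟨q, hq⟩ := hne
  -- The frame tensor at one point with its second index lowered by the metric: the linear map
  -- taking the frame `X, Y, l` to `X', Y', l'`. Constancy of the tensor makes this the same map at
  -- every point.
  let A : Matrix (Fin 3) (Fin 3) ℝ :=
    Matrix.of fun i k => frameTensor F X' Y' l' X Y l i k q * (![-1, 1, 1] : Fin 3 → ℝ) k
  have hA : ∀ p ∈ D, ∀ w, A.mulVec w =
      (mink w (Y p) / F p) • X' p + (mink w (X p) / F p) • Y' p + mink w (l p) • l' p := by
    intro p hp w
    have := hF0 p hp
    ext i
    simp only [A, Matrix.mulVec, dotProduct, Matrix.of_apply,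
      h'.frameTensor_eq hD hc hF hF0 h _ _ hq hp, Fin.sum_univ_three]
    simp [frameTensor, mink]
    field_simp
    ring
  have hAX : ∀ p ∈ D, A.mulVec (X p) = X' p := fun p hp => by
    rw [hA p hp, (fr p hp).XX, (fr p hp).XY, (fr p hp).Xl, div_self (hF0 p hp)]; simp
  have hAY : ∀ p ∈ D, A.mulVec (Y p) = Y' p := fun p hp => by
    rw [hA p hp, (fr p hp).YY, mink_comm, (fr p hp).XY, (fr p hp).Yl, div_self (hF0 p hp)]; simp
  have hAl : A.mulVec (l q) = l' q := by
    rw [hA q hq, mink_comm, (fr q hq).Yl, mink_comm, (fr q hq).Xl, (fr q hq).ll]; simp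
  refine ⟨A, fun a c => ?_, ?_, fun p hp => ⟨hAX p hp, hAY p hp⟩⟩
  -- `A` keeps the coefficients and replaces the frame by one with the same Gram matrix.
  · rw [hA q hq a, hA q hq c, (fr' q hq).mink_comb, ← (fr q hq).mink_comb,
      ← (fr q hq).decomp (hF0 q hq), ← (fr q hq).decomp (hF0 q hq)]
  · have e := det_mulVec A (X q) (Y q) (l q)
    rw [hAX q hq, hAY q hq, hAl, ← mink_cross, ← mink_cross, or q hq, or' q hq] at e
    exact (mul_eq_right₀ (hF0 q hq)).1 e.symm

namespace IsCanonicalCMC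

variable {x y : ℝ × ℝ → Fin 3 → ℝ} {p₀ : ℝ × ℝ} {ε₁ ε₂ δ₁ δ₂ : ℝ}

/-- Restriction to a smaller domain, with a new initial point. -/
theorem mono (h : IsCanonicalCMC x D p₀ ε₁ ε₂ H) (hD : IsCoordStar D p₀) {V : Set (ℝ × ℝ)}
    {q : ℝ × ℝ} (hV : IsOpen V) (hVD : V ⊆ D) (hq : q ∈ V) : IsCanonicalCMC x V q ε₁ ε₂ H where
  surface := ⟨hV, h.surface.smooth.mono hVD, fun p hp => h.surface.lorentz p (hVD hp)⟩
  generalType p hp := h.generalType p (hVD hp)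
  canonical := ⟨fun p hp => h.canonical.isotropic p (hVD hp), hq, h.canonical.sign₁,
    h.canonical.sign₂, fun _ hu => h.coeffL_eq hD _ (hVD hu), fun _ hv => h.coeffN_eq hD _ (hVD hv)⟩
  mean p hp := h.mean p (hVD hp)

theorem coeffF_eq (hx : IsCanonicalCMC x D p₀ ε₁ ε₂ H) (hy : IsCanonicalCMC y D p₀ δ₁ δ₂ H)
    (hD : IsCoordStar D p₀) (hK : EqOn (gaussCurv y) (gaussCurv x) D) :
    EqOn (coeffF y) (coeffF x) D := fun p hp => by
  have h1 := hx.sqrt_abs_eq hD p hp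
  rw [← hK hp, hy.sqrt_abs_eq hD p hp] at h1
  exact inv_injective h1

/-- The product of the signs is the sign of `H² - K`, so the curvature fixes the pair of signs up to
a common factor `-1`. -/
theorem sign_mul_eq (hx : IsCanonicalCMC x D p₀ ε₁ ε₂ H) (hy : IsCanonicalCMC y D p₀ δ₁ δ₂ H)
    (hD : IsCoordStar D p₀) (hK : EqOn (gaussCurv y) (gaussCurv x) D) : δ₁ * δ₂ = ε₁ * ε₂ := by
  have h1 := hx.sq_sub_gaussCurv hD p₀ hD.1
  rw [← hK hD.1, hy.sq_sub_gaussCurv hD p₀ hD.1, hx.coeffF_eq hy hD hK hD.1] at h1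
  have F0 := (hx.canonical.isotropic p₀ hD.1).2.2
  exact (div_left_inj' (by positivity)).1 h1

/-- Equal curvature and equal signs give equal `F`, `L`, `N`, so both frames solve one
Gauss-Weingarten system and differ by a constant proper Lorentz map `A`. Then `y - A x` has zero
differential, which provides the translation. -/
theorem properlyCongruent (hx : IsCanonicalCMC x D p₀ ε₁ ε₂ H)
    (hy : IsCanonicalCMC y D p₀ ε₁ ε₂ H) (hD : IsCoordStar D p₀)
    (hK : EqOn (gaussCurv y) (gaussCurv x) D) : ProperlyCongruent x y D := by
  have hO := hx.surface.isOpen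
  have hc := hD.isPreconnected
  have hFF := hx.coeffF_eq hy hD hK
  have Ix := hx.canonical.isotropic
  have Iy := hy.canonical.isotropic
  have wx := hx.surface.solvesGaussWeingarten Ix hx.mean
  have wy := (hy.surface.solvesGaussWeingarten Iy hy.mean).congr hO hFF
    (L' := coeffL x) (N' := coeffN x)
    (fun p hp => by rw [hx.coeffL_eq hD p hp, hy.coeffL_eq hD p hp])
    (fun p hp => by rw [hx.coeffN_eq hD p hp, hy.coeffN_eq hD p hp])
  have dx : ∀ p ∈ D, DifferentiableAt ℝ x p := fun p hp =>
    (hx.surface.smooth.contDiffAt (hO.mem_nhds hp)).differentiableAt (by simp)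
  have dy : ∀ p ∈ D, DifferentiableAt ℝ y p := fun p hp =>
    (hy.surface.smooth.contDiffAt (hO.mem_nhds hp)).differentiableAt (by simp)
  obtain ⟨A, hA, hdet, hAXY⟩ := wx.exists_motion hO hc ⟨p₀, hD.1⟩
    (fun p hp => (hx.surface.contDiffOn_coeffF.contDiffAt (hO.mem_nhds hp)).differentiableAt
      (by simp)) (fun p hp => (Ix p hp).2.2.ne') wy (fun p hp => Ix.isNullFrame hp)
    (fun p hp => by rw [← hFF hp]; exact Iy.isNullFrame hp)
    (fun p hp => Ix.mink_cross_normal hp)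
    (fun p hp => by rw [← hFF hp]; exact Iy.mink_cross_normal hp)
  have dAx : ∀ p ∈ D, DifferentiableAt ℝ (fun q => (-A).mulVec (x q) + 0) p := fun p hp =>
    (fderiv_mulVec_add (-A) 0 (dx p hp)).differentiableAt
  refine ⟨A, y p₀ - A.mulVec (x p₀), hA, hdet, fun p hp => ?_⟩
  have e := eqOn_const_of_du_dv_eq_zero (f := fun q => y q + ((-A).mulVec (x q) + 0)) hO hc
    (fun p hp => (dy p hp).add (dAx p hp))
    (fun p hp => by
      rw [du_add (dy p hp) (dAx p hp), du_mulVec_add _ _ (dx p hp), Matrix.neg_mulVec,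
        (hAXY p hp).1, add_neg_cancel])
    (fun p hp => by
      rw [dv_add (dy p hp) (dAx p hp), dv_mulVec_add _ _ (dx p hp), Matrix.neg_mulVec,
        (hAXY p hp).2, add_neg_cancel]) hp hD.1
  simp only [Matrix.neg_mulVec, add_zero, ← sub_eq_add_neg] at e
  rw [← e]; abel

end IsCanonicalCMC
end Uniqueness

/-! ### Vector-valued linear systems through the matrix Frobenius theorem. -/

section MatrixSystem

attribute [local instance] Matrix.linftyOpNormedRing Matrix.linftyOpNormedAlgebra

variable {n : ℕ} {D : Set (ℝ × ℝ)}

theorem contDiffOn_matrix {m : ℝ × ℝ → Matrix (Fin n) (Fin n) ℝ}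
    (h : ∀ i j, ContDiffOn ℝ ∞ (fun p => m p i j) D) : ContDiffOn ℝ ∞ m D := by
  have e : m = fun p => ∑ i, ∑ j, m p i j • Matrix.single i j (1 : ℝ) := by
    ext1 p
    conv_lhs => rw [Matrix.matrix_eq_sum_single (m p)]
    simp [Matrix.smul_single]
  rw [e]
  exact ContDiffOn.sum fun i _ => ContDiffOn.sum fun j _ => (h i j).smul contDiffOn_const

theorem hasFDerivAt_linear_comp {k : ℕ} {P : ℝ × ℝ → Matrix (Fin n) (Fin n) ℝ} {p : ℝ × ℝ}
    (hP : DifferentiableAt ℝ P p) (T : Matrix (Fin n) (Fin n) ℝ →ₗ[ℝ] (Fin k → ℝ)) :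
    HasFDerivAt (fun q => T (P q)) ((LinearMap.toContinuousLinearMap T).comp (fderiv ℝ P p)) p :=
  ((LinearMap.toContinuousLinearMap T).hasFDerivAt).comp p hP.hasFDerivAt

theorem fderiv_entry {P : ℝ × ℝ → Matrix (Fin n) (Fin n) ℝ} {p w : ℝ × ℝ}
    (hP : DifferentiableAt ℝ P p) (i j : Fin n) :
    fderiv ℝ P p w i j = fderiv ℝ (fun q => P q i j) p w := by
  have h : HasFDerivAt (fun q => P q i j)
    ((LinearMap.toContinuousLinearMap (Matrix.entryLinearMap ℝ ℝ i j)).comp (fderiv ℝ P p)) p :=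
    ((LinearMap.toContinuousLinearMap (Matrix.entryLinearMap ℝ ℝ i j)).hasFDerivAt).comp p
      hP.hasFDerivAt
  rw [h.fderiv]
  rfl

/-- The linear map `M ↦ (M C)ₖ`, the `k`-th row of `M C`. -/
def rowMul {m : ℕ} (C : Matrix (Fin n) (Fin m) ℝ) (k : Fin n) :
    Matrix (Fin n) (Fin n) ℝ →ₗ[ℝ] (Fin m → ℝ) where
  toFun M := (M * C) k
  map_add' M N := by rw [Matrix.add_mul]; rfl
  map_smul' c M := by rw [Matrix.smul_mul]; rfl

theorem rowMul_mul {m : ℕ} (C : Matrix (Fin n) (Fin m) ℝ) (k : Fin n)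
    (A P : Matrix (Fin n) (Fin n) ℝ) : rowMul C k (A * P) = ∑ i, A k i • rowMul C i P := by
  ext j
  simp only [rowMul, LinearMap.coe_mk, AddHom.coe_mk, Matrix.mul_assoc, Finset.sum_apply,
    Pi.smul_apply, smul_eq_mul]
  exact Matrix.mul_apply

/-- Local solvability of a compatible linear system for vector-valued functions with prescribed
initial values. -/
theorem exists_solution_vector_system {m : ℕ} {a b : ℝ × ℝ → Matrix (Fin n) (Fin n) ℝ}
    (hD : IsOpen D) (ha : ∀ i j, ContDiffOn ℝ ∞ (fun p => a p i j) D)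
    (hb : ∀ i j, ContDiffOn ℝ ∞ (fun p => b p i j) D)
    (hcomp : ∀ p ∈ D, (Matrix.of fun i j => dv (fun q => a q i j) p) + a p * b p =
      (Matrix.of fun i j => du (fun q => b q i j) p) + b p * a p) {p₀ : ℝ × ℝ} (hp₀ : p₀ ∈ D)
    (C : Matrix (Fin n) (Fin m) ℝ) :
    ∃ r > 0, ball p₀ r ⊆ D ∧ ∃ f : Fin n → ℝ × ℝ → Fin m → ℝ,
      (∀ k, ContDiffOn ℝ ∞ (f k) (ball p₀ r)) ∧ (∀ k, f k p₀ = C k) ∧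
      ∀ k, ∀ p ∈ ball p₀ r, du (f k) p = ∑ i, a p k i • f i p ∧
        dv (f k) p = ∑ i, b p k i • f i p := by
  have sa := contDiffOn_matrix ha
  have sb := contDiffOn_matrix hb
  have : CompleteSpace (Matrix (Fin n) (Fin n) ℝ) := FiniteDimensional.complete ℝ _
  obtain ⟨r, hr, hrD, P, hP, hP0, hPd⟩ := exists_solution_linear_system hD sa sb (fun p hp => by
    have h := hcomp p hp
    have da := (sa.contDiffAt (hD.mem_nhds hp)).differentiableAt (by simp)
    have db := (sb.contDiffAt (hD.mem_nhds hp)).differentiableAt (by simp)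
    have e1 : dv a p = Matrix.of fun i j => dv (fun q => a q i j) p := by
      ext i j; exact fderiv_entry da i j
    have e2 : du b p = Matrix.of fun i j => du (fun q => b q i j) p := by
      ext i j; exact fderiv_entry db i j
    rw [e1, e2]; exact h) hp₀
  -- The unknown vectors are the rows of `P C`; since `P` is the identity at `p₀`, they start at the
  -- rows of `C`.
  refine ⟨r, hr, hrD, fun k p => rowMul C k (P p), fun k => ?_, fun k => ?_, fun k p hp => ?_⟩
  · exact (LinearMap.toContinuousLinearMap (rowMul C k)).contDiff.comp_contDiffOn hP
  · simp [hP0, rowMul]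
  · have dP := (hP.contDiffAt (isOpen_ball.mem_nhds hp)).differentiableAt (by simp)
    have h := (hasFDerivAt_linear_comp dP (rowMul C k)).fderiv
    rw [du, dv, h]
    constructor
    · refine Eq.trans ?_ (rowMul_mul C k (a p) (P p))
      rw [← (hPd p hp).1]; rfl
    · refine Eq.trans ?_ (rowMul_mul C k (b p) (P p))
      rw [← (hPd p hp).2]; rfl

end MatrixSystem

/-! ### Construction of a surface from its metric coefficient. -/

section Existence

/-- The hypothesis says that the matrix with columns `X, Y, l` has the metric dual frame as a right
inverse. A right inverse of a square matrix is a left inverse, and the entries of that identity are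
the frame relations. -/
theorem isNullFrame_of_completeness {F : ℝ} (hF : F ≠ 0) {X Y l : Fin 3 → ℝ}
    (h : ∀ i j, (X i * Y j + Y i * X j) / F + l i * l j =
      (Matrix.diagonal ![-1, 1, 1] : Matrix (Fin 3) (Fin 3) ℝ) i j) : IsNullFrame F X Y l := by
  let P : Matrix (Fin 3) (Fin 3) ℝ := Matrix.of fun i k => ![X i, Y i, l i] k
  let Q : Matrix (Fin 3) (Fin 3) ℝ :=
    Matrix.of fun k j => ![Y j / F, X j / F, l j] k * (![-1, 1, 1] : Fin 3 → ℝ) j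
  have hPQ : P * Q = 1 := by
    ext i j
    have hij := h i j
    rw [Matrix.mul_apply, Fin.sum_univ_three]
    have e : P i 0 * Q 0 j + P i 1 * Q 1 j + P i 2 * Q 2 j =
        ((X i * Y j + Y i * X j) / F + l i * l j) * (![-1, 1, 1] : Fin 3 → ℝ) j := by
      simp [P, Q]; ring
    rw [e, hij]
    fin_cases i <;> fin_cases j <;> simp
  have hQP : Q * P = 1 := mul_eq_one_comm.1 hPQ
  have e (i j) := congrFun (congrFun hQP i) j
  simp only [Matrix.mul_apply, Fin.sum_univ_three, P, Q, Matrix.of_apply] at e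
  have e00 := e 0 0
  have e01 := e 0 1
  have e02 := e 0 2
  have e10 := e 1 0
  have e12 := e 1 2
  have e22 := e 2 2
  simp at e00 e01 e02 e10 e12 e22
  field_simp at e00 e01 e02 e10 e12
  constructor <;> simp only [mink] <;> linarith

theorem fderiv_cross {f g : ℝ × ℝ → Fin 3 → ℝ} {p w : ℝ × ℝ} (hf : DifferentiableAt ℝ f p)
    (hg : DifferentiableAt ℝ g p) : DifferentiableAt ℝ (fun q => cross (f q) (g q)) p ∧
      fderiv ℝ (fun q => cross (f q) (g q)) p w =
        cross (fderiv ℝ f p w) (g p) + cross (f p) (fderiv ℝ g p w) := by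
  have hf' := differentiableAt_pi.1 hf
  have hg' := differentiableAt_pi.1 hg
  have hd : DifferentiableAt ℝ (fun q => cross (f q) (g q)) p := by
    refine differentiableAt_pi.2 fun i => ?_
    fin_cases i <;> simp [cross] <;> fun_prop
  refine ⟨hd, ?_⟩
  have hm : ∀ i j, DifferentiableAt ℝ (fun q => f q i * g q j) p := fun i j =>
    (hf' i).mul (hg' j)
  have key : ∀ i j k m, fderiv ℝ (fun q => f q i * g q j - f q k * g q m) p w =
      fderiv ℝ f p w i * g p j + f p i * fderiv ℝ g p w j -
        (fderiv ℝ f p w k * g p m + f p k * fderiv ℝ g p w m) := by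
    intro i j k m
    rw [fderiv_fun_sub (hm i j) (hm k m), sub_apply,
      fderiv_mul_apply (hf' i) (hg' j), fderiv_mul_apply (hf' k) (hg' m),
      fderiv_pi_apply hf, fderiv_pi_apply hf, fderiv_pi_apply hg, fderiv_pi_apply hg]
  ext i
  rw [← fderiv_pi_apply hd]
  fin_cases i
  · simp only [cross]
    have := key 2 1 1 2
    simp [neg_sub] at this ⊢
    rw [this]; ring
  · simp only [cross]
    have := key 2 0 0 2
    simp at this ⊢
    rw [this]; ring
  · simp only [cross]
    have := key 0 1 1 0
    simp at this ⊢
    rw [this]; ring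

variable {H : ℝ} {F L N : ℝ × ℝ → ℝ} {X Y l : ℝ × ℝ → Fin 3 → ℝ} {D : Set (ℝ × ℝ)}

/-- Along a solution of the Gauss-Weingarten equations, `det (X, Y, l) / F` is constant. -/
theorem SolvesGaussWeingarten.det_div_eq (hD : IsOpen D) (hc : IsPreconnected D)
    (hF : ∀ p ∈ D, DifferentiableAt ℝ F p) (hF0 : ∀ p ∈ D, F p ≠ 0)
    (h : SolvesGaussWeingarten H F L N X Y l D) {p q : ℝ × ℝ} (hp : p ∈ D) (hq : q ∈ D) :
    mink (cross (X p) (Y p)) (l p) / F p = mink (cross (X q) (Y q)) (l q) / F q := by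
  have dC : ∀ p ∈ D, DifferentiableAt ℝ (fun q => cross (X q) (Y q)) p := fun p hp =>
    (fderiv_cross (w := 0) (h.diffX p hp) (h.diffY p hp)).1
  have dM : ∀ p ∈ D, DifferentiableAt ℝ (fun q => mink (cross (X q) (Y q)) (l q)) p :=
    fun p hp => differentiableAt_mink (dC p hp) (h.diffl p hp)
  have key : ∀ p ∈ D, ∀ w, fderiv ℝ (fun q => mink (cross (X q) (Y q)) (l q) / F q) p w =
      ((mink (cross (fderiv ℝ X p w) (Y p) + cross (X p) (fderiv ℝ Y p w)) (l p) +
        mink (cross (X p) (Y p)) (fderiv ℝ l p w)) * F p -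
        mink (cross (X p) (Y p)) (l p) * fderiv ℝ F p w) / F p ^ 2 := by
    intro p hp w
    rw [fderiv_div_apply (dM p hp) (hF p hp) (hF0 p hp),
      fderiv_mink (dC p hp) (h.diffl p hp), (fderiv_cross (h.diffX p hp) (h.diffY p hp)).2]
  refine eqOn_const_of_du_dv_eq_zero (f := fun q => mink (cross (X q) (Y q)) (l q) / F q) hD hc
    (fun p hp => differentiableAt_div (dM p hp) (hF p hp) (hF0 p hp))
    (fun p hp => ?_) (fun p hp => ?_) hp hq
  -- The `u`-system for `(X, Y, l)` has trace `F_u / F`, so the determinant grows at the same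
  -- logarithmic rate as `F`; likewise in `v`.
  · have e := key p hp (1, 0)
    have a1 := h.X_u p hp
    have a2 := h.Y_u p hp
    have a3 := h.l_u p hp
    simp only [du] at a1 a2 a3
    rw [du, e, a1, a2, a3]
    have := hF0 p hp
    refine div_eq_zero_iff.2 (Or.inl ?_)
    simp [mink, cross]
    field_simp
    ring
  · have e := key p hp (0, 1)
    have a1 := h.X_v p hp
    have a2 := h.Y_v p hp
    have a3 := h.l_v p hp
    simp only [dv] at a1 a2 a3
    rw [dv, e, a1, a2, a3]
    have := hF0 p hp
    refine div_eq_zero_iff.2 (Or.inl ?_)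
    simp [mink, cross]
    field_simp
    ring

/-- A solution of the Gauss-Weingarten equations with constant `L = ε₁`, `N = ε₂` is the frame of
a surface in canonical coordinates. -/
theorem isCanonicalCMC_of_frame {x : ℝ × ℝ → Fin 3 → ℝ} {ε₁ ε₂ : ℝ} {p₀ : ℝ × ℝ} (hD : IsOpen D)
    (hx : ContDiffOn ℝ ∞ x D) (hX : EqOn (du x) X D) (hY : EqOn (dv x) Y D)
    (hF0 : ∀ p ∈ D, 0 < F p)
    (h : SolvesGaussWeingarten H F (fun _ => ε₁) (fun _ => ε₂) X Y l D)
    (fr : ∀ p ∈ D, IsNullFrame (F p) (X p) (Y p) (l p))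
    (or : ∀ p ∈ D, mink (cross (X p) (Y p)) (l p) = F p)
    (h₁ : ε₁ = 1 ∨ ε₁ = -1) (h₂ : ε₂ = 1 ∨ ε₂ = -1) (hp₀ : p₀ ∈ D) :
    IsCanonicalCMC x D p₀ ε₁ ε₂ H ∧ ∀ p ∈ D, gaussCurv x p = H ^ 2 - ε₁ * ε₂ / F p ^ 2 := by
  have cE : ∀ p ∈ D, coeffE x p = 0 := fun p hp => by rw [coeffE, hX hp, (fr p hp).XX]
  have cF : ∀ p ∈ D, coeffF x p = F p := fun p hp => by rw [coeffF, hX hp, hY hp, (fr p hp).XY]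
  have cG : ∀ p ∈ D, coeffG x p = 0 := fun p hp => by rw [coeffG, hY hp, (fr p hp).YY]
  have hI : IsIsotropic x D := fun p hp => ⟨cE p hp, cG p hp, by rw [cF p hp]; exact hF0 p hp⟩
  -- The orientation relation enters here: it excludes `l = -normal x`, which would reverse the
  -- signs of `L`, `M`, `N`.
  have nl : ∀ p ∈ D, mink (l p) (normal x p) = 1 := fun p hp => by
    rw [hI.normal_eq hp, cF p hp, hX hp, hY hp, mink_smul_right, mink_comm, or p hp,
      inv_mul_cancel₀ (hF0 p hp).ne']
  have nX : ∀ p ∈ D, mink (X p) (normal x p) = 0 := fun p hp => by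
    rw [← hX hp]; exact (hI.isNullFrame hp).Xl
  have nY : ∀ p ∈ D, mink (Y p) (normal x p) = 0 := fun p hp => by
    rw [← hY hp]; exact (hI.isNullFrame hp).Yl
  have cL : ∀ p ∈ D, coeffL x p = ε₁ := fun p hp => by
    rw [coeffL, du_congr_on hD hX hp, h.X_u p hp, mink_add_left, mink_smul_left, mink_smul_left,
      nl p hp, nX p hp]; ring
  have cM : ∀ p ∈ D, coeffM x p = H * F p := fun p hp => by
    rw [coeffM, dv_congr_on hD hX hp, h.X_v p hp, mink_smul_left, nl p hp]; ring
  have cN : ∀ p ∈ D, coeffN x p = ε₂ := fun p hp => by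
    rw [coeffN, dv_congr_on hD hY hp, h.Y_v p hp, mink_add_left, mink_smul_left, mink_smul_left,
      nl p hp, nY p hp]; ring
  have hH : ∀ p ∈ D, meanCurv x p = H := fun p hp => by
    rw [hI.meanCurv_eq hp, cM p hp, cF p hp, mul_div_cancel_right₀ _ (hF0 p hp).ne']
  have hK : ∀ p ∈ D, gaussCurv x p = H ^ 2 - ε₁ * ε₂ / F p ^ 2 := fun p hp => by
    have := (hF0 p hp).ne'
    rw [hI.gaussCurv_eq hp, cM p hp, cF p hp, cL p hp, cN p hp]
    field_simp
  refine ⟨⟨⟨hD, hx, fun p hp => ?_⟩, fun p hp => ?_, ⟨hI, hp₀, h₁, h₂, fun u hu => cL _ hu,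
    fun v hv => cN _ hv⟩, hH⟩, hK⟩
  · have := hF0 p hp
    rw [cE p hp, cG p hp, cF p hp, zero_mul, zero_sub, neg_lt_zero]
    positivity
  · have := (hF0 p hp).ne'
    rw [hH p hp, hK p hp, sub_sub_cancel]
    rcases h₁ with rfl | rfl <;> rcases h₂ with rfl | rfl <;> simpa using this

/-- **Local existence**: a positive solution `F` of the Gauss equation is the metric coefficient
of a surface of constant mean curvature in canonical coordinates. -/
theorem exists_isCanonicalCMC {ε₁ ε₂ : ℝ} {p₀ : ℝ × ℝ} (hD : IsOpen D)
    (hF : ContDiffOn ℝ ∞ F D) (hF0 : ∀ p ∈ D, 0 < F p)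
    (hG : ∀ p ∈ D, dv (fun q => du F q / F q) p = ε₁ * ε₂ / F p - H ^ 2 * F p)
    (h₁ : ε₁ = 1 ∨ ε₁ = -1) (h₂ : ε₂ = 1 ∨ ε₂ = -1) (hp₀ : p₀ ∈ D) :
    ∃ r > 0, ball p₀ r ⊆ D ∧ ∀ s, 0 < s → s ≤ r → ∃ x : ℝ × ℝ → Fin 3 → ℝ,
      IsCanonicalCMC x (ball p₀ s) p₀ ε₁ ε₂ H ∧
      ∀ p ∈ ball p₀ s, gaussCurv x p = H ^ 2 - ε₁ * ε₂ / F p ^ 2 := by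
  have sFu := contDiffOn_du hD hF
  have sFv := contDiffOn_dv hD hF
  have dF : ∀ p ∈ D, DifferentiableAt ℝ F p := fun p hp =>
    (hF.contDiffAt (hD.mem_nhds hp)).differentiableAt (by simp)
  have dFu : ∀ p ∈ D, DifferentiableAt ℝ (du F) p := fun p hp =>
    (sFu.contDiffAt (hD.mem_nhds hp)).differentiableAt (by simp)
  have dFv : ∀ p ∈ D, DifferentiableAt ℝ (dv F) p := fun p hp =>
    (sFv.contDiffAt (hD.mem_nhds hp)).differentiableAt (by simp)
  have F0 : ∀ p ∈ D, F p ≠ 0 := fun p hp => (hF0 p hp).ne'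
  have sg : ContDiffOn ℝ ∞ (fun q => du F q / F q) D := sFu.div hF F0
  have sh : ContDiffOn ℝ ∞ (fun q => dv F q / F q) D := sFv.div hF F0
  have hG' : ∀ p ∈ D, du (fun q => dv F q / F q) p = ε₁ * ε₂ / F p - H ^ 2 * F p := by
    intro p hp
    rw [← hG p hp, du_div (dFv p hp) (dF p hp) (F0 p hp), dv_div (dFu p hp) (dF p hp) (F0 p hp),
      dv_du_comm (hF.contDiffAt (hD.mem_nhds hp))]
    ring
  have sHF : ContDiffOn ℝ ∞ (fun q => H * F q) D := contDiffOn_const.mul hF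
  have sεF : ∀ ε : ℝ, ContDiffOn ℝ ∞ (fun q => -(ε / F q)) D := fun ε =>
    (contDiffOn_const.div hF F0).neg
  have uεF : ∀ ε : ℝ, ∀ p ∈ D, du (fun q => -(ε / F q)) p = ε * du F p / F p ^ 2 := by
    intro ε p hp
    have e : (fun q => -(ε / F q)) = fun q => -ε / F q := by ext q; ring
    rw [e, du_div (differentiableAt_const _) (dF p hp) (F0 p hp), du_const]
    ring
  have vεF : ∀ ε : ℝ, ∀ p ∈ D, dv (fun q => -(ε / F q)) p = ε * dv F p / F p ^ 2 := by
    intro ε p hp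
    have e : (fun q => -(ε / F q)) = fun q => -ε / F q := by ext q; ring
    rw [e, dv_div (differentiableAt_const _) (dF p hp) (F0 p hp), dv_const]
    ring
  -- The unknowns are `(x, X, Y, l)`. The first rows of `a` and `b` encode `x_u = X` and `x_v = Y`,
  -- so the position is integrated together with the frame.
  let a (q : ℝ × ℝ) : Matrix (Fin 4) (Fin 4) ℝ :=
    !![0, 1, 0, 0; 0, du F q / F q, 0, ε₁; 0, 0, 0, H * F q; 0, -H, -(ε₁ / F q), 0]
  let b (q : ℝ × ℝ) : Matrix (Fin 4) (Fin 4) ℝ :=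
    !![0, 0, 1, 0; 0, 0, 0, H * F q; 0, 0, dv F q / F q, ε₂; 0, -(ε₂ / F q), -H, 0]
  have sa : ∀ i j, ContDiffOn ℝ ∞ (fun p => a p i j) D := by
    intro i j
    fin_cases i <;> fin_cases j <;>
      first | exact contDiffOn_const | exact sg | exact sHF | exact sεF _
  have sb : ∀ i j, ContDiffOn ℝ ∞ (fun p => b p i j) D := by
    intro i j
    fin_cases i <;> fin_cases j <;>
      first | exact contDiffOn_const | exact sh | exact sHF | exact sεF _
  have va : ∀ p ∈ D, (Matrix.of fun i j => dv (fun q => a q i j) p) =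
      !![0, 0, 0, 0; 0, ε₁ * ε₂ / F p - H ^ 2 * F p, 0, 0; 0, 0, 0, H * dv F p;
        0, 0, ε₁ * dv F p / F p ^ 2, 0] := by
    intro p hp
    ext i j
    fin_cases i <;> fin_cases j <;>
      first | exact dv_const _ | exact hG p hp | exact dv_const_mul (dF p hp) H | exact vεF _ p hp
  have ub : ∀ p ∈ D, (Matrix.of fun i j => du (fun q => b q i j) p) =
      !![0, 0, 0, 0; 0, 0, 0, H * du F p; 0, 0, ε₁ * ε₂ / F p - H ^ 2 * F p, 0;
        0, ε₂ * du F p / F p ^ 2, 0, 0] := by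
    intro p hp
    ext i j
    fin_cases i <;> fin_cases j <;>
      first | exact du_const _ | exact hG' p hp | exact du_const_mul (dF p hp) H | exact uεF _ p hp
  -- With `L` and `N` constant the Codazzi part is automatic; the diagonal entries for `X` and `Y`
  -- are the Gauss equation.
  have hcomp : ∀ p ∈ D, (Matrix.of fun i j => dv (fun q => a q i j) p) + a p * b p =
      (Matrix.of fun i j => du (fun q => b q i j) p) + b p * a p := by
    intro p hp
    rw [va p hp, ub p hp]
    have := F0 p hp
    ext i j
    fin_cases i <;> fin_cases j <;> simp [a, b] <;>
      field_simp <;> ring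
  -- Initially `x = 0`, `X = (1, 1, 0)`, `Y = (F/2)(-1, 1, 0)`, `l = (0, 0, 1)`: a null frame with
  -- `⟨X, Y⟩ = det (X, Y, l) = F`.
  obtain ⟨r, hr, hrD, f, hf, hf0, hfd⟩ := exists_solution_vector_system hD sa sb hcomp hp₀
    (!![0, 0, 0; 1, 1, 0; -(F p₀ / 2), F p₀ / 2, 0; 0, 0, 1] : Matrix (Fin 4) (Fin 3) ℝ)
  refine ⟨r, hr, hrD, fun s hs hsr => ⟨f 0, ?_⟩⟩
  have hsr' : ball p₀ s ⊆ ball p₀ r := ball_subset_ball hsr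
  have hsD := hsr'.trans hrD
  have hdiff : ∀ k, ∀ p ∈ ball p₀ s, DifferentiableAt ℝ (f k) p := fun k p hp =>
    ((hf k).contDiffAt (isOpen_ball.mem_nhds (hsr' hp))).differentiableAt (by simp)
  have hW : SolvesGaussWeingarten H F (fun _ => ε₁) (fun _ => ε₂) (f 1) (f 2) (f 3)
      (ball p₀ s) := by
    refine ⟨hdiff 1, hdiff 2, hdiff 3, fun p hp => ?_, fun p hp => ?_, fun p hp => ?_,
      fun p hp => ?_, fun p hp => ?_, fun p hp => ?_⟩
    · rw [(hfd 1 p (hsr' hp)).1]; simp [Fin.sum_univ_four, a]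
    · rw [(hfd 1 p (hsr' hp)).2]; simp [Fin.sum_univ_four, b]
    · rw [(hfd 2 p (hsr' hp)).1]; simp [Fin.sum_univ_four, a]
    · rw [(hfd 2 p (hsr' hp)).2]; simp [Fin.sum_univ_four, b]
    · rw [(hfd 3 p (hsr' hp)).1]; simp [Fin.sum_univ_four, a]
    · rw [(hfd 3 p (hsr' hp)).2]; simp [Fin.sum_univ_four, b]
  have hc : IsPreconnected (ball p₀ s) := (convex_ball p₀ s).isPreconnected
  have hm := mem_ball_self (x := p₀) hs
  have Fp₀ := F0 p₀ hp₀
  have dFs : ∀ p ∈ ball p₀ s, DifferentiableAt ℝ F p := fun p hp => dF p (hsD hp)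
  have F0s : ∀ p ∈ ball p₀ s, F p ≠ 0 := fun p hp => F0 p (hsD hp)
  refine isCanonicalCMC_of_frame isOpen_ball ((hf 0).mono hsr') (X := f 1) (Y := f 2) (l := f 3)
    (fun p hp => ?_) (fun p hp => ?_) (fun p hp => hF0 p (hsD hp)) hW (fun p hp => ?_)
    (fun p hp => ?_) h₁ h₂ hm
  · rw [(hfd 0 p (hsr' hp)).1]; simp [Fin.sum_univ_four, a]
  · rw [(hfd 0 p (hsr' hp)).2]; simp [Fin.sum_univ_four, b]
  · refine isNullFrame_of_completeness (F0s p hp) fun i j => ?_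
    -- The frame is paired with itself: the tensor is constant, and at `p₀` it is the inverse
    -- metric.
    refine (hW.frameTensor_eq isOpen_ball hc dFs F0s hW i j hp hm).trans ?_
    simp only [frameTensor, hf0]
    fin_cases i <;> fin_cases j <;> simp
    · field_simp; norm_num
    · exact Fp₀
  · have h := hW.det_div_eq isOpen_ball hc dFs F0s hp hm
    simp only [hf0] at h
    have e : mink (cross ((!![0, 0, 0; 1, 1, 0; -(F p₀ / 2), F p₀ / 2, 0; 0, 0, 1] :
        Matrix (Fin 4) (Fin 3) ℝ) 1) ((!![0, 0, 0; 1, 1, 0; -(F p₀ / 2), F p₀ / 2, 0; 0, 0, 1] :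
        Matrix (Fin 4) (Fin 3) ℝ) 2)) ((!![0, 0, 0; 1, 1, 0; -(F p₀ / 2), F p₀ / 2, 0; 0, 0, 1] :
        Matrix (Fin 4) (Fin 3) ℝ) 3) = F p₀ := by
      simp [mink, cross]
    rw [e, div_self Fp₀] at h
    exact (div_eq_one_iff_eq (F0s p hp)).1 h

end Existence

/-! ### The two surfaces attached to a solution of the natural equation. -/

section Classification

variable {H : ℝ} {K : ℝ × ℝ → ℝ} {D : Set (ℝ × ℝ)}

theorem isCoordStar_ball (p₀ : ℝ × ℝ) {r : ℝ} (hr : 0 < r) : IsCoordStar (ball p₀ r) p₀ :=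
  ⟨mem_ball_self hr, fun _ hp => ⟨fun _ ht => mem_ball_left_of_mem_uIcc hp ht,
    fun _ ht => mem_ball_right_of_mem_uIcc hp ht⟩⟩

theorem contDiffOn_sqrt_abs {f : ℝ × ℝ → ℝ} (hf : ContDiffOn ℝ ∞ f D) (h0 : ∀ p ∈ D, f p ≠ 0) :
    ContDiffOn ℝ ∞ (fun p => Real.sqrt |f p|) D := fun p hp =>
  ((contDiffAt_abs (h0 p hp)).comp_contDiffWithinAt p (hf p hp)).sqrt (abs_ne_zero.2 (h0 p hp))

/-- The natural equation as an equation for the metric coefficient `F = |H² - K|^(-1/2)`. -/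
theorem NaturalEq.dv_du_div (hD : IsOpen D) (hK : ContDiffOn ℝ ∞ K D) (h : NaturalEq H K D)
    {F : ℝ × ℝ → ℝ} (hFK : ∀ p, F p = (Real.sqrt |H ^ 2 - K p|)⁻¹) :
    ContDiffOn ℝ ∞ F D ∧ (∀ p ∈ D, 0 < F p) ∧
      ∀ p ∈ D, dv (fun q => du F q / F q) p = -(K p * F p) := by
  have h0 : ∀ p ∈ D, 0 < Real.sqrt |H ^ 2 - K p| := fun p hp =>
    Real.sqrt_pos.2 (abs_pos.2 (h p hp).1)
  have hF0 : ∀ p ∈ D, 0 < F p := fun p hp => by rw [hFK]; exact inv_pos.2 (h0 p hp)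
  have sF : ContDiffOn ℝ ∞ F D := by
    rw [funext hFK]
    exact (contDiffOn_sqrt_abs (contDiffOn_const.sub hK) fun p hp => (h p hp).1).inv
      fun p hp => (h0 p hp).ne'
  refine ⟨sF, hF0, fun p hp => ?_⟩
  have dF : ∀ q ∈ D, DifferentiableAt ℝ F q := fun q hq =>
    (sF.contDiffAt (hD.mem_nhds hq)).differentiableAt (by simp)
  have dFu : DifferentiableAt ℝ (du F) p :=
    ((contDiffOn_du hD sF).contDiffAt (hD.mem_nhds hp)).differentiableAt (by simp)
  have e1 : (fun q => Real.log (Real.sqrt |H ^ 2 - K q|)) = fun q => -Real.log (F q) := by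
    ext q; rw [hFK, Real.log_inv, neg_neg]
  have e2 : EqOn (du fun q => -Real.log (F q)) (fun q => -1 * (du F q / F q)) D := fun q hq =>
    du_neg_log (dF q hq) (hF0 q hq).ne'
  have h1 := (h p hp).2
  rw [e1, dv_congr_on hD e2 hp, dv_const_mul (differentiableAt_div dFu (dF p hp) (hF0 p hp).ne'),
    ← inv_inv (Real.sqrt |H ^ 2 - K p|), ← hFK] at h1
  have := (hF0 p hp).ne'
  field_simp at h1
  linarith

theorem exists_pair_isCanonicalCMC (hD : IsOpen D) (hK : ContDiffOn ℝ ∞ K D)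
    (h : NaturalEq H K D) {p₀ : ℝ × ℝ} (hp₀ : p₀ ∈ D) :
    ∃ r > 0, ball p₀ r ⊆ D ∧ ∃ (ε : ℝ) (x₁ x₂ : ℝ × ℝ → Fin 3 → ℝ),
      IsCanonicalCMC x₁ (ball p₀ r) p₀ 1 ε H ∧ (∀ p ∈ ball p₀ r, gaussCurv x₁ p = K p) ∧
      IsCanonicalCMC x₂ (ball p₀ r) p₀ (-1) (-ε) H ∧ ∀ p ∈ ball p₀ r, gaussCurv x₂ p = K p := by
  obtain ⟨F, hF⟩ : ∃ F : ℝ × ℝ → ℝ, ∀ p, F p = (Real.sqrt |H ^ 2 - K p|)⁻¹ := ⟨_, fun _ => rfl⟩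
  obtain ⟨sF, hF0, hG⟩ := h.dv_du_div hD hK hF
  obtain ⟨ε, hε, hεp⟩ : ∃ ε : ℝ, (ε = 1 ∨ ε = -1) ∧ 0 < ε * (H ^ 2 - K p₀) := by
    rcases lt_or_gt_of_ne (h p₀ hp₀).1 with hlt | hgt
    · exact ⟨-1, Or.inr rfl, by linarith⟩
    · exact ⟨1, Or.inl rfl, by linarith⟩
  -- `D` need not be connected; restricting to the points where `H² - K` has the sign it has at `p₀`
  -- makes `H² - K = ε / F²` valid throughout.
  let D' : Set (ℝ × ℝ) := D ∩ (fun p => ε * (H ^ 2 - K p)) ⁻¹' Ioi 0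
  have hD' : IsOpen D' := ((contDiffOn_const.mul (contDiffOn_const.sub hK)).continuousOn
    (f := fun p => ε * (H ^ 2 - K p))).isOpen_inter_preimage hD isOpen_Ioi
  have hsub : D' ⊆ D := inter_subset_left
  have hKF : ∀ p ∈ D', H ^ 2 - K p = ε / F p ^ 2 := by
    intro p hp
    have hpos : 0 < ε * (H ^ 2 - K p) := hp.2
    rw [hF]
    simp only [inv_pow, Real.sq_sqrt (abs_nonneg _), div_inv_eq_mul]
    rcases hε with rfl | rfl
    · rw [abs_of_pos (by linarith)]; ring
    · rw [abs_of_neg (by linarith)]; ring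
  have hG' : ∀ p ∈ D', dv (fun q => du F q / F q) p = ε / F p - H ^ 2 * F p := by
    intro p hp
    have := (hF0 p (hsub hp)).ne'
    rw [hG p (hsub hp), show K p = H ^ 2 - ε / F p ^ 2 by linarith [hKF p hp]]
    field_simp
    ring
  have hε' : -ε = 1 ∨ -ε = -1 := by rcases hε with rfl | rfl <;> simp
  obtain ⟨r₁, hr₁, hrD, hx₁⟩ := exists_isCanonicalCMC (ε₁ := 1) (ε₂ := ε) hD' (sF.mono hsub)
    (fun p hp => hF0 p (hsub hp)) (by simpa using hG') (Or.inl rfl) hε ⟨hp₀, hεp⟩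
  obtain ⟨r₂, hr₂, -, hx₂⟩ := exists_isCanonicalCMC (ε₁ := -1) (ε₂ := -ε) hD' (sF.mono hsub)
    (fun p hp => hF0 p (hsub hp)) (by simpa using hG') (Or.inr rfl) hε' ⟨hp₀, hεp⟩
  -- Each construction works on every smaller concentric ball, so both surfaces can share one
  -- domain.
  have hb : ball p₀ (min r₁ r₂) ⊆ D' := (ball_subset_ball (min_le_left _ _)).trans hrD
  obtain ⟨x₁, c₁, k₁⟩ := hx₁ (min r₁ r₂) (lt_min hr₁ hr₂) (min_le_left _ _)
  obtain ⟨x₂, c₂, k₂⟩ := hx₂ (min r₁ r₂) (lt_min hr₁ hr₂) (min_le_right _ _)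
  refine ⟨min r₁ r₂, lt_min hr₁ hr₂, hb.trans hsub, ε, x₁, x₂, c₁, fun p hp => ?_, c₂,
    fun p hp => ?_⟩
  · rw [k₁ p hp, one_mul, ← hKF p (hb hp)]; ring
  · rw [k₂ p hp, neg_mul_neg, one_mul, ← hKF p (hb hp)]; ring

end Classification
end LorentzSurface

end

/-! ### The correspondence theorem. -/

theorem mainTheorem2 :
    -- surfaces satisfy the natural equation, and proper motions preserve the solution
    (∀ (H : ℝ) (D : Set (ℝ × ℝ)) (p₀ : ℝ × ℝ) (ε₁ ε₂ : ℝ) (x : ℝ × ℝ → Fin 3 → ℝ),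
      H ≠ 0 → LorentzSurface.IsCoordStar D p₀ →
      LorentzSurface.IsCanonicalCMC x D p₀ ε₁ ε₂ H →
        LorentzSurface.NaturalEq H (LorentzSurface.gaussCurv x) D ∧
        ∀ y : ℝ × ℝ → Fin 3 → ℝ, LorentzSurface.ProperlyCongruent x y D →
          LorentzSurface.IsCanonicalCMC y D p₀ ε₁ ε₂ H ∧
          (∀ p ∈ D, LorentzSurface.gaussCurv y p = LorentzSurface.gaussCurv x p) ∧
          LorentzSurface.NaturalEq H (LorentzSurface.gaussCurv y) D) ∧
    -- solutions of the natural equation determine locally exactly two surfaces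
    (∀ (H : ℝ) (D : Set (ℝ × ℝ)) (K : ℝ × ℝ → ℝ) (p₀ : ℝ × ℝ),
      H ≠ 0 → IsOpen D → ContDiffOn ℝ ∞ K D → LorentzSurface.NaturalEq H K D → p₀ ∈ D →
        ∃ U : Set (ℝ × ℝ),
          (∃ a b c d : ℝ, U = Set.Ioo a b ×ˢ Set.Ioo c d) ∧ p₀ ∈ U ∧ U ⊆ D ∧
          ∃ (ε₁ ε₂ : ℝ) (x₁ x₂ : ℝ × ℝ → Fin 3 → ℝ),
            LorentzSurface.IsCanonicalCMC x₁ U p₀ ε₁ ε₂ H ∧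
            (∀ p ∈ U, LorentzSurface.gaussCurv x₁ p = K p) ∧
            LorentzSurface.IsCanonicalCMC x₂ U p₀ (-ε₁) (-ε₂) H ∧
            (∀ p ∈ U, LorentzSurface.gaussCurv x₂ p = K p) ∧
            ∀ (V : Set (ℝ × ℝ)) (q₀ : ℝ × ℝ),
              IsOpen V → V ⊆ U → LorentzSurface.IsCoordStar V q₀ →
                ¬ LorentzSurface.ProperlyCongruent x₁ x₂ V ∧
                ∀ (δ₁ δ₂ : ℝ) (y : ℝ × ℝ → Fin 3 → ℝ),
                  LorentzSurface.IsCanonicalCMC y V q₀ δ₁ δ₂ H →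
                  (∀ p ∈ V, LorentzSurface.gaussCurv y p = K p) →
                    (δ₁ = ε₁ ∧ δ₂ = ε₂ ∧ LorentzSurface.ProperlyCongruent x₁ y V) ∨
                    (δ₁ = -ε₁ ∧ δ₂ = -ε₂ ∧ LorentzSurface.ProperlyCongruent x₂ y V)) := by
  refine ⟨fun H D p₀ ε₁ ε₂ x _ hD hx => ⟨hx.naturalEq hD, fun y hy => ?_⟩,
    fun H D K p₀ _ hD hK h hp₀ => ?_⟩
  · have hy' := hx.of_properlyCongruent hy
    exact ⟨hy', fun p hp => (hy.curv_eq hx.surface p hp).1, hy'.naturalEq hD⟩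
  obtain ⟨r, hr, hrD, ε, x₁, x₂, c₁, k₁, c₂, k₂⟩ :=
    LorentzSurface.exists_pair_isCanonicalCMC hD hK h hp₀
  have hU := LorentzSurface.isCoordStar_ball p₀ hr
  refine ⟨Metric.ball p₀ r, ⟨p₀.1 - r, p₀.1 + r, p₀.2 - r, p₀.2 + r, ?_⟩, hU.1, hrD, 1, ε, x₁, x₂,
    c₁, k₁, c₂, k₂, fun V q₀ hV hVU hVs => ?_⟩
  -- Balls of the product metric are open squares.
  · rw [← Real.ball_eq_Ioo, ← Real.ball_eq_Ioo, ball_prod_same]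
  have m₁ := c₁.mono hU hV hVU hVs.1
  have m₂ := c₂.mono hU hV hVU hVs.1
  refine ⟨fun hc => ?_, fun δ₁ δ₂ y hy hyK => ?_⟩
  -- A proper motion preserves `L`, which is `1` on one surface and `-1` on the other.
  · have e := (hc.coeff_eq m₁.surface q₀ hVs.1).2.2.2.1
    rw [m₁.coeffL_eq hVs q₀ hVs.1, m₂.coeffL_eq hVs q₀ hVs.1] at e
    norm_num at e
  have e₁ : Set.EqOn (LorentzSurface.gaussCurv y) (LorentzSurface.gaussCurv x₁) V :=
    fun p hp => (hyK p hp).trans (k₁ p (hVU hp)).symm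
  have e₂ : Set.EqOn (LorentzSurface.gaussCurv y) (LorentzSurface.gaussCurv x₂) V :=
    fun p hp => (hyK p hp).trans (k₂ p (hVU hp)).symm
  have hs := m₁.sign_mul_eq hy hVs e₁
  -- Since `δ₁ δ₂ = ε`, the first sign decides the second.
  rcases hy.canonical.sign₁ with rfl | rfl
  · obtain rfl : δ₂ = ε := by linarith
    exact Or.inl ⟨rfl, rfl, m₁.properlyCongruent hy hVs e₁⟩
  · obtain rfl : δ₂ = -ε := by linarith
    exact Or.inr ⟨rfl, rfl, m₂.properlyCongruent hy hVs e₂⟩
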